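/- Let $p\in[0,1]$ and $\delta_{\rm in},\delta_{\rm out}\ge 0$. Let $\{B_k\}_{k\ge1}$ be iid Bernoulli($p$) variables, put $|V(n)|=1+\sum_{k=1}^n B_k$, $V(n)=\{1,\dots,|V(n)|\}$, $S_1=0$ and $S_v=\inf\{n\ge1:\ 1+\sum_{k=1}^nB_k=v\}$ for $v\ge2$. **The traditional preferential attachment model.** Let $\{\tau_{n,v},\widetilde\tau_{n,v}:n,v\ge1\}$ be iid unit-rate exponential variables, independent of $\{B_k\}$. The in- and out-degree sequences $(\mathbf I(m),\mathbf O(m))=((I_v(m),O_v(m)))_{v\ge1}$ start from $(\mathbf I(0),\mathbf O(0))=((1,1),(0,0),\dots)$. For $n\ge0$ let $$J_{n+1}=\operatorname*{argmin}_{v\in V(n)}\frac{\tau_{n+1,v}}{I_v(2n)+\delta_{\rm in}},\qquad \widetilde J_{n+1}=\operatorname*{argmin}_{v\in V(n)}\frac{\widetilde\tau_{n+1,v}}{O_v(2n)+\delta_{\rm out}}$$ (a quotient with denominator $0$ is $+\infty$). At time $2n+1$ the in-degree of node $J_{n+1}$ is raised by one. At time $2n+2$ the out-degree of node $\widetilde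 J_{n+1}$ is raised by one if $B_{n+1}=0$, and the new node $|V(n)|+1$ receives out-degree one if $B_{n+1}=1$. Nothing else changes. **The birth-immigration processes.** For $\delta\ge0$, $BI_\delta$ denotes a right-continuous continuous-time Markov chain on $\mathbb N$, started from $0$, whose only transitions are $k\to k+1$, at rate $k+\delta$. Let $BI^{(v)}_{\mathbf 1_{\{v=1\}}+\delta_{\rm in}}$ and $\widetilde{BI}{}^{(v)}_{1+\delta_{\rm out}}$, $v\ge1$, be independent such processes with the indicated immigration parameters, independent of $\{B_k\}$. **The embedded jump times.** Let $\Gamma_0=0$, and let $\Gamma_{n+1}$ be the first time after $\Gamma_n$ at which one of the processes $BI^{(v)}_{\mathbf 1_{\{v=1\}}+\delta_{\rm in}}(\,\cdot-\Gamma_{S_v})$, $v\in V(n)$, jumps. Let $\widetilde\Gamma_0=0$. If $B_{n+1}=1$ let $\widetilde\Gamma_{n+1}=\widetilde\Gamma_n$; if $B_{n+1}=0$ let $\widetilde\Gamma_{n+1}$ be the first time after $\widetilde\Gamma_n$ at which one of the processes $\widetilde{BI}{}^{(v)}_{1+\delta_{\rm out}}(\,\cdot-\widetilde\Gamma_{S_v})$,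 $v\in V(n)$, jumps. **Theorem.** Conditionally on $\{B_k:k\ge1\}$ (equality of regular conditional laws, almost surely), $$\{\mathbf I(2n):n\ge0\}\stackrel d=\Big\{\Big(\big\{\mathbf 1_{\{v=1\}}+BI^{(v)}_{\mathbf 1_{\{v=1\}}+\delta_{\rm in}}(\Gamma_n-\Gamma_{S_v})\big\}_{v\in V(n)},0,\dots\Big):n\ge0\Big\},$$ $$\{\mathbf O(2n):n\ge0\}\stackrel d=\Big\{\Big(\big\{1+\widetilde{BI}{}^{(v)}_{1+\delta_{\rm out}}(\widetilde\Gamma_n-\widetilde\Gamma_{S_v})\big\}_{v\in V(n)},0,\dots\Big):n\ge0\Big\}.$$ Moreover, for each fixed $n\ge0$, both conditionally on $\{B_k:k\ge1\}$ and unconditionally, $$\big(\mathbf I(2n),\mathbf O(2n)\big)\stackrel d=\Big(\Big(\mathbf 1_{\{v=1\}}+BI^{(v)}_{\mathbf 1_{\{v=1\}}+\delta_{\rm in}}(\Gamma_n-\Gamma_{S_v}),\ 1+\widetilde{BI}{}^{(v)}_{1+\delta_{\rm out}}(\widetilde\Gamma_n-\widetilde\Gamma_{S_v})\Big)_{v\in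 V(n)},(0,0),\dots\Big).$$ -/

import Mathlib

open MeasureTheory ProbabilityTheory
open scoped NNReal ENNReal

/-!
Indexing conventions.  Nodes are labelled `0, 1, 2, …`, node `0` being the initial node.  The entry
`b n` of a sequence `b : ℕ → Bool` is the Bernoulli variable used at step `n + 1` (the step from the
graph with `n + 1` edges to the graph with `n + 2` edges); `true` is the value `1`, "a new node is
created".  In the same way `τ n v`, `τ' n v` are the exponential variables used at step `n + 1`.
-/

namespace PrefAttach

noncomputable section

/-- Number of nodes after `n` steps, `1 + ∑_{k ≤ n} B_k`; the nodes present after `n` steps are the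
`v` with `v < nodeCount b n`. -/
def nodeCount (b : ℕ → Bool) (n : ℕ) : ℕ := 1 + ∑ k ∈ Finset.range n, (b k).toNat

/-- `S_v`, the first step after which node `v` is present (so `S = 0` for the initial node). -/
def creationTime (b : ℕ → Bool) (v : ℕ) : ℕ := sInf {n | nodeCount b n = v + 1}

/-! ### The preferential attachment model -/

/-- The argument of the minimum of `f` over `{0, …, N - 1}` (the least one in case of ties). -/
def argminBelow (N : ℕ) (f : ℕ → ℝ≥0∞) : ℕ := sInf {v | v < N ∧ ∀ w < N, f v ≤ f w}

/-- The exponential clock `τ / (d + δ)` of a node of degree `d`; it is infinite, that is, it never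
rings, when `d + δ = 0 < τ`. -/
def clock (δ : ℝ≥0) (τ : ℝ) (d : ℕ) : ℝ≥0∞ := ENNReal.ofReal τ / ((d : ℝ≥0∞) + δ)

/-- The sequence of (in-degree, out-degree) pairs, indexed by half-steps and by nodes.  The process
starts from one node with a self-loop.  Half-step `2n → 2n + 1` raises by one the in-degree of the
existing node whose in-clock rings first; half-step `2n + 1 → 2n + 2` gives out-degree one to a new
node if `b n`, and otherwise raises by one the out-degree of the existing node whose out-clock rings
first (the out-degrees at times `2n` and `2n + 1` agree).  The degrees in the graph after `n` steps
are those at time `2n`. -/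
def degrees (δin δout : ℝ≥0) (b : ℕ → Bool) (τ τ' : ℕ → ℕ → ℝ) : ℕ → ℕ → ℕ × ℕ
  | 0 => Pi.single 0 (1, 1)
  | m + 1 =>
    let D := degrees δin δout b τ τ' m
    let n := m / 2
    let N := nodeCount b n
    if m % 2 = 0 then
      D + Pi.single (argminBelow N fun v => clock δin (τ n v) (D v).1) (1, 0)
    else if b n then
      D + Pi.single N (0, 1)
    else
      D + Pi.single (argminBelow N fun v => clock δout (τ' n v) (D v).2) (0, 1)

/-- In-degrees of all nodes after `n` steps. -/
def inDegree (δin δout : ℝ≥0) (b : ℕ → Bool) (τ τ' : ℕ → ℕ → ℝ) (n v : ℕ) : ℕ :=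
  (degrees δin δout b τ τ' (2 * n) v).1

/-- Out-degrees of all nodes after `n` steps. -/
def outDegree (δin δout : ℝ≥0) (b : ℕ → Bool) (τ τ' : ℕ → ℕ → ℝ) (n v : ℕ) : ℕ :=
  (degrees δin δout b τ τ' (2 * n) v).2

/-! ### Linear birth-immigration processes -/

/-- The time at which a path first reaches level `k` (`∞` if it never does). -/
def hittingTime (x : ℝ≥0 → ℕ) (k : ℕ) : ℝ≥0∞ := ⨅ (t : ℝ≥0) (_ : k ≤ x t), (t : ℝ≥0∞)

/-- `X` is a linear birth-immigration process with unit lifetime parameter and immigration parameter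
`δ`, started from `0`: the (minimal, right-continuous) continuous-time Markov chain on `ℕ` whose only
transitions are `k → k + 1`, at rate `k + δ`.  Its holding times in the states `0, 1, 2, …` are
independent and exponential with rates `δ, 1 + δ, 2 + δ, …` (rate zero meaning an infinite holding
time), that is, they are `e i / (i + δ)` with `e 0, e 1, …` independent unit exponentials, and the
time at which `k` is reached is the sum of the first `k` of them. -/
structure IsBirthImmigration {Ω : Type*} [MeasurableSpace Ω] (μ : Measure Ω) (δ : ℝ≥0)
    (X : ℝ≥0 → Ω → ℕ) : Prop where
  measurable : ∀ t, Measurable (X t)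
  start : ∀ᵐ ω ∂μ, X 0 ω = 0
  monotone : ∀ᵐ ω ∂μ, Monotone fun t => X t ω
  rightContinuous : ∀ᵐ ω ∂μ, ∀ t, ContinuousWithinAt (fun s => X s ω) (Set.Ici t) t
  hittingTimes :
    μ.map (fun ω (k : ℕ) => hittingTime (fun t => X t ω) k) =
      (Measure.infinitePi fun _ : ℕ => expMeasure 1).map
        (fun e (k : ℕ) => ∑ i ∈ Finset.range k, ENNReal.ofReal (e i) / ((i : ℝ≥0∞) + δ))

/-! ### The embedded jump times -/

/-- Given paths `x v` started at the times `s v`, the first time after `t₀` at which one of the paths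
`t ↦ x v (t - s v)`, `v < N`, jumps, i.e. leaves the value it has at `t₀`. -/
def nextJump (N : ℕ) (s : ℕ → ℝ≥0) (x : ℕ → ℝ≥0 → ℕ) (t₀ : ℝ≥0) : ℝ≥0 :=
  sInf {t | t₀ < t ∧ ∃ v < N, x v (t - s v) ≠ x v (t₀ - s v)}

/-- The jump times `Γ_n`: `Γ_0 = 0`, and `Γ_{n+1}` is the first time after `Γ_n` at which one of the
processes `x v (· - Γ_{S_v})`, `v < nodeCount b n`, jumps.  For these `v` one has `S_v ≤ n` (see
`creationTime_le`), so that the `min` below only serves the recursion (see `inJumpTime_succ`). -/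
def inJumpTime (b : ℕ → Bool) (x : ℕ → ℝ≥0 → ℕ) : ℕ → ℝ≥0
  | 0 => 0
  | n + 1 =>
    nextJump (nodeCount b n) (fun v => inJumpTime b x (min (creationTime b v) n)) x
      (inJumpTime b x n)
  termination_by n => n

/-- The jump times for the out-degrees: as `inJumpTime`, except that the clock does not advance in
steps at which a new node is created; the new process is then started at the current time. -/
def outJumpTime (b : ℕ → Bool) (x : ℕ → ℝ≥0 → ℕ) : ℕ → ℝ≥0
  | 0 => 0
  | n + 1 =>
    if b n then outJumpTime b x n
    else
      nextJump (nodeCount b n) (fun v => outJumpTime b x (min (creationTime b v) n)) x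
        (outJumpTime b x n)
  termination_by n => n

/-- The family `1_{v = initial node} + x_v (Γ_n - Γ_{S_v})` for the nodes `v` present after `n`
steps, padded by zeros. -/
def inEmbedding (b : ℕ → Bool) (x : ℕ → ℝ≥0 → ℕ) (n v : ℕ) : ℕ :=
  if v < nodeCount b n then
    (if v = 0 then 1 else 0) + x v (inJumpTime b x n - inJumpTime b x (creationTime b v))
  else 0

/-- The family `1 + x_v (Γ_n - Γ_{S_v})`, with the out-degree jump times, for the nodes `v` present
after `n` steps, padded by zeros. -/
def outEmbedding (b : ℕ → Bool) (x : ℕ → ℝ≥0 → ℕ) (n v : ℕ) : ℕ :=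
  if v < nodeCount b n then
    1 + x v (outJumpTime b x n - outJumpTime b x (creationTime b v))
  else 0

theorem exists_nodeCount_eq (b : ℕ → Bool) (n v : ℕ) (h : v < nodeCount b n) :
    ∃ m ≤ n, nodeCount b m = v + 1 := by
  induction n with
  | zero => exact ⟨0, le_rfl, by simp [nodeCount] at h ⊢; omega⟩
  | succ n ih =>
    by_cases hv : v < nodeCount b n
    · obtain ⟨m, hm, h'⟩ := ih hv
      exact ⟨m, by omega, h'⟩
    · refine ⟨n + 1, le_rfl, ?_⟩
      have hb := Bool.toNat_le (b n)
      simp only [nodeCount, Finset.sum_range_succ] at h hv ⊢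
      omega

theorem creationTime_le (b : ℕ → Bool) (n v : ℕ) (h : v < nodeCount b n) :
    creationTime b v ≤ n := by
  obtain ⟨m, hm, h'⟩ := exists_nodeCount_eq b n v h
  exact (show sInf {n | nodeCount b n = v + 1} ≤ m from Nat.sInf_le h').trans hm

theorem nextJump_congr {N : ℕ} {s s' : ℕ → ℝ≥0} (h : ∀ v < N, s v = s' v) (x : ℕ → ℝ≥0 → ℕ)
    (t₀ : ℝ≥0) : nextJump N s x t₀ = nextJump N s' x t₀ := by
  unfold nextJump
  congr 1
  ext t
  refine and_congr_right fun _ => exists_congr fun v => and_congr_right fun hv => ?_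
  rw [h v hv]

theorem inJumpTime_succ (b : ℕ → Bool) (x : ℕ → ℝ≥0 → ℕ) (n : ℕ) :
    inJumpTime b x (n + 1) =
      nextJump (nodeCount b n) (fun v => inJumpTime b x (creationTime b v)) x
        (inJumpTime b x n) := by
  rw [inJumpTime]
  exact nextJump_congr (fun v hv => by rw [min_eq_left (creationTime_le b n v hv)]) x _

theorem outJumpTime_succ (b : ℕ → Bool) (x : ℕ → ℝ≥0 → ℕ) (n : ℕ) :
    outJumpTime b x (n + 1) =
      if b n then outJumpTime b x n
      else nextJump (nodeCount b n) (fun v => outJumpTime b x (creationTime b v)) x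
        (outJumpTime b x n) := by
  rw [outJumpTime]
  split_ifs
  · rfl
  · exact nextJump_congr (fun v hv => by rw [min_eq_left (creationTime_le b n v hv)]) x _

end

end PrefAttach

/-! Fix the sequence `b` of new-node decisions. In both constructions the degrees are then one and
the same function, `tally`, of the sequence of chosen nodes: an initial degree plus a number of
wins. The rate degree + `δ` equals wins + (initial degree + `δ`), so the initial degree is absorbed
into the immigration parameter `ρ v`; this is why the processes start from `0`. It remains to
compare the laws of the two sequences of winners.

With fresh exponentials, a given history of winners fixes the rates, so the next winner depends only
on the new row of variables, and a history has as probability a product of factors `stepProb`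
(`infinitePi_urnWinner`). For the birth-immigration processes, record for every node the waiting
times until all its future jumps. At the first jump, won by `j`, lack of memory restores the law of
the other nodes' residual waiting times, while node `j` is now one state higher; all of this is
independent of the identity of `j` (`raceLaw_firstToJump_inter_advance`). Iteration yields the same
product (`raceLaw_raceWinner`).

The races are tied to the actual paths by a deterministic induction on `PathInvariant`: at the
embedded jump times each path equals its number of races won (`apply_jumpTimes_eq_counts`). This
needs positive waiting times, so that no two jumps coincide, and a finite clock at node `0`. Both
hold almost surely. The second uses `ρ 0 ≠ 0`; other in-clocks may never ring when `δin = 0`.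

Finally, the in- and out-parts are driven by independent inputs, also independent of `b`, so by
Fubini equality for every fixed `b` gives equality of the joint laws of `b` with the whole pair of
degree processes (`map_degrees_eq_map_embeddings`). Every assertion of the theorem is an image of
this identity, since conditional laws are determined by joint laws. -/

namespace PrefAttach

/-! ### Exponential clocks and the lack of memory -/

/-- The image of `M` restricted to `V` under `φ` is proportional to `M` itself. -/
def RegeneratesOn {E : Type*} [MeasurableSpace E] (M : Measure E) (V : Set E) (φ : E → E) : Prop :=
  ∀ A, MeasurableSet A → M (V ∩ φ ⁻¹' A) = M V * M A

instance isProbabilityMeasure_expMeasure_one : IsProbabilityMeasure (expMeasure 1) :=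
  isProbabilityMeasure_expMeasure one_pos

theorem expMeasure_one_eq : expMeasure 1 = volume.withDensity (exponentialPDF 1) := rfl

theorem expMeasure_one_singleton (x : ℝ) : expMeasure 1 {x} = 0 := by
  rw [expMeasure_one_eq]
  exact withDensity_absolutelyContinuous _ _ (measure_singleton x)

theorem ae_pos_expMeasure_one : ∀ᵐ x ∂expMeasure 1, 0 < x := by
  have h : expMeasure 1 (Set.Iio 0) = 0 := by
    rw [expMeasure_one_eq, withDensity_apply _ measurableSet_Iio]
    exact lintegral_exponentialPDF_of_nonpos le_rfl
  have h2 : expMeasure 1 (Set.Iic 0) = 0 := by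
    rw [← Set.Iio_union_right]
    exact measure_union_null h (expMeasure_one_singleton 0)
  rw [ae_iff]
  simpa [Set.Iic] using h2

/-- The density satisfies `exp (-(y + c)) = exp (-c) * exp (-y)`, and Lebesgue measure is
translation invariant. -/
theorem expMeasure_one_shift {c : ℝ} (hc : 0 ≤ c) {A : Set ℝ} (hA : MeasurableSet A) :
    expMeasure 1 (Set.Ioi c ∩ (· - c) ⁻¹' A) = ENNReal.ofReal (Real.exp (-c)) * expMeasure 1 A := by
  have hm : MeasurableSet (Set.Ioi c ∩ (· - c) ⁻¹' A) :=
    measurableSet_Ioi.inter ((measurable_id.sub_const c) hA)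
  -- Dropping the null part of `A` outside `(0, ∞)` makes the two integrands translates of each
  -- other at every point.
  have h0 : expMeasure 1 A = expMeasure 1 (Set.Ioi 0 ∩ A) := by
    refine measure_congr ?_
    filter_upwards [ae_pos_expMeasure_one] with x hx
    exact propext ⟨fun h => ⟨hx, h⟩, fun h => h.2⟩
  have hg : ∀ x, (Set.Ioi c ∩ (· - c) ⁻¹' A).indicator (exponentialPDF 1) x =
      (fun y => ENNReal.ofReal (Real.exp (-c)) *
        (Set.Ioi 0 ∩ A).indicator (exponentialPDF 1) y) (x - c) := by
    intro x
    by_cases hx : c < x ∧ x - c ∈ A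
    · have h1 : x ∈ Set.Ioi c ∩ (· - c) ⁻¹' A := hx
      have h2 : x - c ∈ Set.Ioi 0 ∩ A := ⟨sub_pos.2 hx.1, hx.2⟩
      simp only [Set.indicator_of_mem h1, Set.indicator_of_mem h2]
      rw [exponentialPDF_of_nonneg (hc.trans hx.1.le), exponentialPDF_of_nonneg (sub_pos.2 hx.1).le,
        ← ENNReal.ofReal_mul (Real.exp_pos _).le, one_mul, one_mul, one_mul, one_mul,
        ← Real.exp_add]
      congr 2
      ring
    · have h1 : x ∉ Set.Ioi c ∩ (· - c) ⁻¹' A := hx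
      have h2 : x - c ∉ Set.Ioi 0 ∩ A := fun h => hx ⟨sub_pos.1 h.1, h.2⟩
      simp [Set.indicator_of_notMem h1, Set.indicator_of_notMem h2]
  rw [h0, expMeasure_one_eq, withDensity_apply _ hm, withDensity_apply _ (measurableSet_Ioi.inter hA),
    ← lintegral_indicator hm, ← lintegral_indicator (measurableSet_Ioi.inter hA),
    ← lintegral_const_mul' _ _ ENNReal.ofReal_ne_top, lintegral_congr hg]
  exact lintegral_sub_right_eq_self
    (fun y => ENNReal.ofReal (Real.exp (-c)) * (Set.Ioi 0 ∩ A).indicator (exponentialPDF 1) y) c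

theorem regeneratesOn_expMeasure_one {c : ℝ} (hc : 0 ≤ c) :
    RegeneratesOn (expMeasure 1) (Set.Ioi c) (· - c) := by
  intro A hA
  have h := expMeasure_one_shift hc MeasurableSet.univ
  rw [Set.preimage_univ, Set.inter_univ, measure_univ, mul_one] at h
  rw [expMeasure_one_shift hc hA, h]

/-- The law of an exponential clock of rate `r`; if `r = 0` the clock never rings. -/
noncomputable def clockLaw (r : ℝ≥0) : Measure ℝ≥0∞ :=
  (expMeasure 1).map fun x => ENNReal.ofReal x / r

theorem measurable_ofReal_div (r : ℝ≥0∞) : Measurable fun x : ℝ => ENNReal.ofReal x / r :=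
  ENNReal.measurable_ofReal.div_const r

instance isProbabilityMeasure_clockLaw (r : ℝ≥0) : IsProbabilityMeasure (clockLaw r) :=
  Measure.isProbabilityMeasure_map (measurable_ofReal_div r).aemeasurable

theorem clockLaw_zero : clockLaw 0 = Measure.dirac ∞ := by
  have h : (fun x : ℝ => ENNReal.ofReal x / ((0 : ℝ≥0) : ℝ≥0∞)) =ᵐ[expMeasure 1] fun _ => ∞ := by
    filter_upwards [ae_pos_expMeasure_one] with x hx
    simp [ENNReal.div_zero, hx]
  rw [clockLaw, Measure.map_congr h, Measure.map_const, measure_univ, one_smul]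

theorem clockLaw_singleton (r : ℝ≥0) {c : ℝ≥0∞} (hc : c ≠ ∞) : clockLaw r {c} = 0 := by
  rcases eq_or_ne r 0 with rfl | hr
  · rw [clockLaw_zero, Measure.dirac_apply' _ (measurableSet_singleton c)]
    simp [hc.symm]
  · rw [clockLaw, Measure.map_apply (measurable_ofReal_div r) (measurableSet_singleton c)]
    refine measure_mono_null (t := {(c * r).toReal} ∪ Set.Iic 0) ?_ ?_
    · intro x hx
      rcases le_or_gt x 0 with h | h
      · exact Or.inr h
      · left
        have hx' : ENNReal.ofReal x / r = c := hx
        rw [Set.mem_singleton_iff, ← hx', ENNReal.div_mul_cancel (by simpa using hr) (by simp),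
          ENNReal.toReal_ofReal h.le]
    · refine measure_union_null (expMeasure_one_singleton _) ?_
      have := ae_pos_expMeasure_one
      rw [ae_iff] at this
      simpa [Set.Iic] using this

theorem clockLaw_singleton_top {r : ℝ≥0} (hr : r ≠ 0) : clockLaw r {∞} = 0 := by
  rw [clockLaw, Measure.map_apply (measurable_ofReal_div r) (measurableSet_singleton _)]
  convert measure_empty (μ := expMeasure 1)
  ext x
  simp [ENNReal.div_eq_top, hr]

theorem measurable_ennreal_sub_const (c : ℝ≥0∞) : Measurable fun x : ℝ≥0∞ => x - c :=
  measurable_id.sub_const c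

theorem regeneratesOn_clockLaw_Ioi (r : ℝ≥0) {c : ℝ≥0∞} (hc : c ≠ ∞) :
    RegeneratesOn (clockLaw r) (Set.Ioi c) (· - c) := by
  intro A hA
  have hmA := measurable_ennreal_sub_const c hA
  rcases eq_or_ne r 0 with rfl | hr
  · rw [clockLaw_zero, Measure.dirac_apply' _ (measurableSet_Ioi.inter hmA),
      Measure.dirac_apply' _ measurableSet_Ioi, Measure.dirac_apply' _ hA]
    have h1 : ∞ ∈ Set.Ioi c := lt_top_iff_ne_top.2 hc
    by_cases h2 : ∞ ∈ A
    · have h3 : ∞ ∈ Set.Ioi c ∩ (· - c) ⁻¹' A := ⟨h1, by simpa [ENNReal.top_sub hc] using h2⟩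
      simp [Set.indicator_of_mem h3, Set.indicator_of_mem h1, Set.indicator_of_mem h2]
    · have h3 : ∞ ∉ Set.Ioi c ∩ (· - c) ⁻¹' A := fun h => h2 (by simpa [ENNReal.top_sub hc] using h.2)
      simp [Set.indicator_of_notMem h3, Set.indicator_of_notMem h2]
  · have hr0 : (r : ℝ≥0∞) ≠ 0 := by simpa using hr
    have hrt : (r : ℝ≥0∞) ≠ ∞ := ENNReal.coe_ne_top
    -- The clock is `x / r`, so the threshold `c` for the clock is the threshold `c * r` for the
    -- exponential variable.
    set d := (c * r).toReal with hd
    have hd' : ENNReal.ofReal d = c * r := ENNReal.ofReal_toReal (ENNReal.mul_ne_top hc hrt)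
    have hd0 : 0 ≤ d := ENNReal.toReal_nonneg
    have h1 : ∀ x : ℝ, c < ENNReal.ofReal x / r ↔ d < x := by
      intro x
      rw [ENNReal.lt_div_iff_mul_lt (Or.inl hr0) (Or.inl hrt), ← hd',
        ENNReal.ofReal_lt_ofReal_iff']
      exact ⟨fun h => h.1, fun h => ⟨h, hd0.trans_lt h⟩⟩
    have h2 : ∀ x : ℝ, ENNReal.ofReal x / r - c = ENNReal.ofReal (x - d) / r := by
      intro x
      rw [ENNReal.ofReal_sub _ hd0, hd', ENNReal.sub_div (fun _ _ => hr0),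
        ENNReal.mul_div_cancel_right hr0 hrt]
    have hm := measurable_ofReal_div (r : ℝ≥0∞)
    rw [clockLaw, Measure.map_apply hm (measurableSet_Ioi.inter hmA),
      Measure.map_apply hm measurableSet_Ioi, Measure.map_apply hm hA]
    have e1 : (fun x : ℝ => ENNReal.ofReal x / r) ⁻¹' Set.Ioi c = Set.Ioi d := by
      ext x; exact h1 x
    have e2 : (fun x : ℝ => ENNReal.ofReal x / r) ⁻¹' (Set.Ioi c ∩ (· - c) ⁻¹' A) =
        Set.Ioi d ∩ (· - d) ⁻¹' ((fun x : ℝ => ENNReal.ofReal x / r) ⁻¹' A) := by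
      ext x
      simp only [Set.mem_preimage, Set.mem_inter_iff, Set.mem_Ioi, h1, h2]
    rw [e1, e2]
    exact regeneratesOn_expMeasure_one hd0 _ (hm hA)

/-- A clock has no atom at a finite time. Both the open and the closed version are needed, because
`argminBelow` breaks ties in favour of the smaller index. -/
theorem regeneratesOn_clockLaw_Ici (r : ℝ≥0) {c : ℝ≥0∞} (hc : c ≠ ∞) :
    RegeneratesOn (clockLaw r) (Set.Ici c) (· - c) := by
  intro A hA
  have h : Set.Ioi c =ᵐ[clockLaw r] Set.Ici c := by
    have : ∀ᵐ x ∂clockLaw r, x ≠ c := by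
      rw [ae_iff]; simpa using clockLaw_singleton r hc
    filter_upwards [this] with x hx
    exact propext ⟨fun h => le_of_lt h, fun h => lt_of_le_of_ne h hx.symm⟩
  have h' : clockLaw r (Set.Ioi c ∩ (· - c) ⁻¹' A) = clockLaw r (Set.Ici c ∩ (· - c) ⁻¹' A) :=
    measure_congr (h.inter (Filter.EventuallyEq.refl _ _))
  rw [← measure_congr h, ← h', regeneratesOn_clockLaw_Ioi r hc A hA]

theorem RegeneratesOn.id {E : Type*} [MeasurableSpace E] (M : Measure E) [IsProbabilityMeasure M] :
    RegeneratesOn M Set.univ id := by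
  intro A _
  simp

/-- Regeneration of finitely many coordinates of a product measure. -/
theorem RegeneratesOn.infinitePi {ι : Type*} {E : ι → Type*} [∀ i, MeasurableSpace (E i)]
    {M : ∀ i, Measure (E i)} [∀ i, IsProbabilityMeasure (M i)] {V : ∀ i, Set (E i)}
    {φ : ∀ i, E i → E i} (s : Finset ι) (hV : ∀ i, MeasurableSet (V i)) (hφ : ∀ i, Measurable (φ i))
    (h : ∀ i, RegeneratesOn (M i) (V i) (φ i)) (hs : ∀ i ∉ s, V i = Set.univ) :
    RegeneratesOn (Measure.infinitePi M) (Set.pi s V) (fun f i => φ i (f i)) := by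
  classical
  set P := Measure.infinitePi M
  set c := P (Set.pi s V)
  have hφ' : Measurable fun (f : ∀ i, E i) i => φ i (f i) := by fun_prop
  have hVs : MeasurableSet (Set.pi (s : Set ι) V) :=
    MeasurableSet.pi s.countable_toSet fun i _ => hV i
  by_cases hc : c = 0
  · intro A hA
    change _ = c * _
    rw [hc, zero_mul]
    exact measure_mono_null Set.inter_subset_left hc
  have hct : c ≠ ∞ := measure_ne_top _ _
  -- For `c ≠ 0` the claim says that the conditioned and transformed measure is again the product
  -- measure, which can be checked on rectangles.
  have key : c⁻¹ • (P.restrict (Set.pi s V)).map (fun f i => φ i (f i)) = P := by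
    refine Measure.eq_infinitePi _ fun u t ht => ?_
    have hpi : MeasurableSet (Set.pi (u : Set ι) t) :=
      MeasurableSet.pi u.countable_toSet fun i _ => ht i
    rw [Measure.smul_apply, Measure.map_apply hφ' hpi, Measure.restrict_apply (hφ' hpi), smul_eq_mul]
    let t' : ∀ i, Set (E i) := fun i => V i ∩ φ i ⁻¹' (if i ∈ u then t i else Set.univ)
    have e : (fun (f : ∀ i, E i) i => φ i (f i)) ⁻¹' Set.pi u t ∩ Set.pi s V =
        Set.pi ((u ∪ s : Finset ι) : Set ι) t' := by
      ext f
      simp only [Set.mem_inter_iff, Set.mem_preimage, Set.mem_pi, Finset.coe_union, Set.mem_union,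
        Finset.mem_coe, t']
      constructor
      · rintro ⟨h1, h2⟩ i _
        refine ⟨?_, ?_⟩
        · by_cases his : i ∈ s
          · exact h2 i his
          · rw [hs i his]; trivial
        · split_ifs with hiu
          · exact h1 i hiu
          · trivial
      · intro h
        refine ⟨fun i hi => ?_, fun i hi => (h i (Or.inr hi)).1⟩
        simpa [hi] using (h i (Or.inl hi)).2
    have ht' : ∀ i, MeasurableSet (if i ∈ u then t i else Set.univ) := fun i => by
      split_ifs
      exacts [ht i, MeasurableSet.univ]
    have hc' : c = ∏ i ∈ u ∪ s, M i (V i) := by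
      rw [← Finset.prod_subset Finset.subset_union_right (f := fun i => M i (V i))
        (fun i _ hi => by rw [hs i hi, measure_univ])]
      exact Measure.infinitePi_pi _ fun i _ => hV i
    rw [e, Measure.infinitePi_pi _ fun i _ => (hV i).inter (hφ i (ht' i)),
      Finset.prod_congr rfl fun i _ => h i _ (ht' i), Finset.prod_mul_distrib, ← hc', ← mul_assoc,
      ENNReal.inv_mul_cancel hc hct, one_mul,
      ← Finset.prod_subset Finset.subset_union_left (f := fun i => M i (if i ∈ u then t i else Set.univ))
        (fun i _ hi => by rw [if_neg hi, measure_univ])]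
    exact Finset.prod_congr rfl fun i hi => by rw [if_pos hi]
  intro A hA
  have := congrArg (fun m => c * m A) key
  simp only [Measure.smul_apply, smul_eq_mul] at this
  rw [← mul_assoc, ENNReal.mul_inv_cancel hc hct, one_mul, Measure.map_apply hφ' hA,
    Measure.restrict_apply (hφ' hA), Set.inter_comm] at this
  exact this

/-! ### Product measures: splitting off a coordinate -/

/-- Only factor `j` changes: the section of a rectangle at `x` has measure equal to a factor
depending on `x` times the product over the other coordinates. This serves to split the row of the
winner into its first waiting time and the rest. -/
theorem infinitePi_map_replace {D E : Type*} [MeasurableSpace D] [MeasurableSpace E]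
    {M M' : ℕ → Measure E} [∀ i, IsProbabilityMeasure (M i)] [∀ i, IsProbabilityMeasure (M' i)]
    {ν : Measure D} [IsProbabilityMeasure ν] (j : ℕ) (hM : ∀ i ≠ j, M' i = M i)
    {κ : D → E → E} (hκ : Measurable fun p : D × E => κ p.1 p.2)
    (hj : (ν.prod (M' j)).map (fun p => κ p.1 p.2) = M j) :
    (ν.prod (Measure.infinitePi M')).map (fun p => Function.update p.2 j (κ p.1 (p.2 j))) =
      Measure.infinitePi M := by
  have hm : Measurable fun p : D × (ℕ → E) => Function.update p.2 j (κ p.1 (p.2 j)) := by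
    refine measurable_pi_iff.2 fun v => ?_
    by_cases hv : v = j
    · subst hv
      simp only [Function.update_self]
      exact hκ.comp (measurable_fst.prodMk ((measurable_pi_apply _).comp measurable_snd))
    · simp only [Function.update_of_ne hv]
      exact (measurable_pi_apply _).comp measurable_snd
  refine Measure.eq_infinitePi _ fun s t ht => ?_
  have hpi : MeasurableSet (Set.pi (s : Set ℕ) t) :=
    MeasurableSet.pi s.countable_toSet fun i _ => ht i
  let t' : ℕ → Set E := fun i => if i ∈ s then t i else Set.univ
  have ht' : ∀ i, MeasurableSet (t' i) := fun i => by
    simp only [t']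
    split_ifs
    exacts [ht i, MeasurableSet.univ]
  rw [Measure.map_apply hm hpi, Measure.prod_apply (hm hpi)]
  have hsec : ∀ x, Measure.infinitePi M' (Prod.mk x ⁻¹'
      ((fun p : D × (ℕ → E) => Function.update p.2 j (κ p.1 (p.2 j))) ⁻¹' Set.pi s t)) =
      M' j (κ x ⁻¹' t' j) * ∏ i ∈ s.erase j, M i (t i) := by
    intro x
    have e : Prod.mk x ⁻¹' ((fun p : D × (ℕ → E) => Function.update p.2 j (κ p.1 (p.2 j))) ⁻¹'
        Set.pi s t) = Set.pi ((insert j (s.erase j) : Finset ℕ) : Set ℕ)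
          (Function.update t j (κ x ⁻¹' t' j)) := by
      ext F
      simp only [Set.mem_preimage, Set.mem_pi, Finset.coe_insert, Set.mem_insert_iff,
        Finset.mem_coe, Finset.mem_erase]
      constructor
      · rintro h i (rfl | ⟨hij, hi⟩)
        · simp only [Function.update_self, Set.mem_preimage, t']
          split_ifs with hi
          · simpa using h i hi
          · trivial
        · simpa [Function.update_of_ne hij] using h i hi
      · intro h i hi
        by_cases hij : i = j
        · subst hij
          simpa [t', hi] using h i (Or.inl rfl)
        · simpa [Function.update_of_ne hij] using h i (Or.inr ⟨hij, hi⟩)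
    have hx : Measurable (κ x) := hκ.comp measurable_prodMk_left
    rw [e, Measure.infinitePi_pi _ fun i _ => ?_, Finset.prod_insert (Finset.notMem_erase _ _),
      Function.update_self]
    · congr 1
      refine Finset.prod_congr rfl fun i hi => ?_
      rw [Function.update_of_ne (Finset.ne_of_mem_erase hi), hM i (Finset.ne_of_mem_erase hi)]
    · by_cases hij : i = j
      · subst hij
        rw [Function.update_self]
        exact hx (ht' i)
      · rw [Function.update_of_ne hij]
        exact ht i
  have hj' : ∫⁻ x, M' j (κ x ⁻¹' t' j) ∂ν = M j (t' j) := by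
    rw [← hj, Measure.map_apply hκ (ht' j), Measure.prod_apply (hκ (ht' j))]
    rfl
  have hmeas : Measurable fun x => M' j (κ x ⁻¹' t' j) :=
    measurable_measure_prodMk_left (hκ (ht' j))
  rw [lintegral_congr hsec, lintegral_mul_const _ hmeas, hj']
  by_cases hjs : j ∈ s
  · rw [← Finset.mul_prod_erase s _ hjs]
    simp [t', hjs]
  · simp [t', hjs]

theorem infinitePi_map_cons {E : Type*} [MeasurableSpace E] {M : ℕ → Measure E}
    [∀ i, IsProbabilityMeasure (M i)] :
    ((M 0).prod (Measure.infinitePi fun i => M (i + 1))).map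
      (fun p i => Nat.casesOn (motive := fun _ => E) i p.1 p.2) = Measure.infinitePi M := by
  have hm : Measurable fun (p : E × (ℕ → E)) (i : ℕ) =>
      (Nat.casesOn (motive := fun _ => E) i p.1 p.2) := by
    refine measurable_pi_iff.2 fun i => ?_
    cases i with
    | zero => exact measurable_fst
    | succ i => exact (measurable_pi_apply i).comp measurable_snd
  refine Measure.eq_infinitePi _ fun s t ht => ?_
  have hpi : MeasurableSet (Set.pi (s : Set ℕ) t) :=
    MeasurableSet.pi s.countable_toSet fun i _ => ht i
  let t' : ℕ → Set E := fun i => if i ∈ s then t i else Set.univ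
  have ht' : ∀ i, MeasurableSet (t' i) := fun i => by
    simp only [t']
    split_ifs
    exacts [ht i, MeasurableSet.univ]
  -- Enlarging `s` to an initial segment allows coordinate `0` to be split off by an index shift.
  obtain ⟨n, hn⟩ : ∃ n, s ⊆ Finset.range (n + 1) :=
    ⟨s.sup id, fun i hi => Finset.mem_range_succ_iff.2 (Finset.le_sup (f := id) hi)⟩
  have e : (fun (p : E × (ℕ → E)) (i : ℕ) => (Nat.casesOn (motive := fun _ => E) i p.1 p.2)) ⁻¹'
      Set.pi s t = t' 0 ×ˢ Set.pi (Finset.range n : Set ℕ) fun i => t' (i + 1) := by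
    ext ⟨x, f⟩
    simp only [Set.mem_preimage, Set.mem_pi, Set.mem_prod, Finset.mem_coe, Finset.mem_range, t']
    constructor
    · intro h
      refine ⟨?_, fun i _ => ?_⟩
      · split_ifs with h0
        exacts [h 0 h0, trivial]
      · split_ifs with hi
        exacts [h (i + 1) hi, trivial]
    · rintro ⟨h0, h⟩ i hi
      cases i with
      | zero => simpa [hi] using h0
      | succ i => simpa [hi] using h i (by simpa using hn hi)
  rw [Measure.map_apply hm hpi, e, Measure.prod_prod, Measure.infinitePi_pi _ fun i _ => ht' (i + 1),
    mul_comm, ← Finset.prod_range_succ' (fun i => M i (t' i)),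
    ← Finset.prod_subset hn (fun i _ hi => by simp [t', hi])]
  exact Finset.prod_congr rfl fun i hi => by simp [t', hi]

/-! ### The jump times of one process -/

noncomputable def partialSums (h : ℕ → ℝ≥0∞) (i : ℕ) : ℝ≥0∞ := ∑ l ∈ Finset.range (i + 1), h l

theorem measurable_partialSums : Measurable partialSums := by
  unfold partialSums
  fun_prop

/-- The law of the successive waiting times until the next jumps of a birth-immigration process with
immigration parameter `ρ` in state `k`. -/
noncomputable def rowLaw (ρ : ℝ≥0) (k : ℕ) : Measure (ℕ → ℝ≥0∞) :=
  (Measure.infinitePi fun i : ℕ => clockLaw ((k + i : ℕ) + ρ)).map partialSums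

instance isProbabilityMeasure_rowLaw (ρ : ℝ≥0) (k : ℕ) : IsProbabilityMeasure (rowLaw ρ k) :=
  Measure.isProbabilityMeasure_map measurable_partialSums.aemeasurable

noncomputable def consRow (x : ℝ≥0∞) (R : ℕ → ℝ≥0∞) : ℕ → ℝ≥0∞
  | 0 => x
  | i + 1 => x + R i

theorem measurable_consRow : Measurable fun p : ℝ≥0∞ × (ℕ → ℝ≥0∞) => consRow p.1 p.2 := by
  refine measurable_pi_iff.2 fun i => ?_
  cases i with
  | zero => exact measurable_fst
  | succ i => exact measurable_fst.add ((measurable_pi_apply i).comp measurable_snd)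

/-- This is the Markov property at the first jump: after an independent clock of rate `k + ρ`, the
process runs on from state `k + 1`, and all later waiting times are increased by the value of that
clock. -/
theorem map_consRow (ρ : ℝ≥0) (k : ℕ) :
    ((clockLaw (k + ρ)).prod (rowLaw ρ (k + 1))).map (fun p => consRow p.1 p.2) = rowLaw ρ k := by
  have h1 : ∀ i, k + 1 + i = k + (i + 1) := fun i => by ring
  have hc : Measurable fun (p : ℝ≥0∞ × (ℕ → ℝ≥0∞)) (i : ℕ) =>
      (Nat.casesOn (motive := fun _ => ℝ≥0∞) i p.1 p.2) := by
    refine measurable_pi_iff.2 fun i => ?_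
    cases i with
    | zero => exact measurable_fst
    | succ i => exact (measurable_pi_apply i).comp measurable_snd
  rw [rowLaw, rowLaw, ← infinitePi_map_cons (M := fun i : ℕ => clockLaw ((k + i : ℕ) + ρ)),
    Measure.map_map measurable_partialSums hc]
  simp only [h1, add_zero]
  have h2 : (clockLaw (k + ρ)).map id = clockLaw (k + ρ) := Measure.map_id
  rw [← h2, Measure.map_prod_map _ _ measurable_id measurable_partialSums, h2,
    Measure.map_map measurable_consRow (measurable_id.prodMap measurable_partialSums)]
  congr 1
  ext ⟨x, h⟩ i
  cases i with
  | zero => simp [consRow, partialSums]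
  | succ i =>
    simp only [Function.comp, Prod.map, consRow, partialSums, id]
    rw [Finset.sum_range_succ' _ (i + 1)]
    exact add_comm _ _

theorem rowLaw_map_zero (ρ : ℝ≥0) (k : ℕ) :
    (rowLaw ρ k).map (fun R => R 0) = clockLaw (k + ρ) := by
  rw [← map_consRow, Measure.map_map (measurable_pi_apply 0) measurable_consRow]
  exact Measure.map_fst_prod.trans (by simp)

/-- Only the first holding time feels the conditioning and the shift by `c`; the later holding times
can be frozen by Fubini, which reduces the claim to a single clock. -/
theorem rowLaw_regeneratesOn (ρ : ℝ≥0) (k : ℕ) {c : ℝ≥0∞} (hc : c ≠ ∞) {V : Set ℝ≥0∞}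
    (hVm : MeasurableSet V) (hV : V ⊆ Set.Ici c) (h : RegeneratesOn (clockLaw (k + ρ)) V (· - c)) :
    RegeneratesOn (rowLaw ρ k) {R | R 0 ∈ V} (fun R i => R i - c) := by
  have key : ∀ A, MeasurableSet A → rowLaw ρ k ({R | R 0 ∈ V} ∩ (fun R i => R i - c) ⁻¹' A) =
      clockLaw (k + ρ) V * rowLaw ρ k A := by
    intro A hA
    have hφ : Measurable fun (R : ℕ → ℝ≥0∞) i => R i - c :=
      measurable_pi_iff.2 fun i => (measurable_ennreal_sub_const c).comp (measurable_pi_apply i)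
    have hS : MeasurableSet ({R : ℕ → ℝ≥0∞ | R 0 ∈ V} ∩ (fun R i => R i - c) ⁻¹' A) :=
      ((measurable_pi_apply 0) hVm).inter (hφ hA)
    rw [← map_consRow, Measure.map_apply measurable_consRow hS,
      Measure.map_apply measurable_consRow hA, Measure.prod_apply_symm (measurable_consRow hS),
      Measure.prod_apply_symm (measurable_consRow hA),
      ← lintegral_const_mul _ (measurable_measure_prodMk_right (measurable_consRow hA))]
    refine lintegral_congr fun R => ?_
    rw [← h _ (measurable_prodMk_right (measurable_consRow hA))]
    congr 1
    ext x
    simp only [Set.mem_preimage, Set.mem_inter_iff, Set.mem_ofPred_eq]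
    refine and_congr_right fun hx => ?_
    have : (fun i => consRow x R i - c) = consRow (x - c) R := by
      ext i
      cases i with
      | zero => rfl
      | succ i => exact (ENNReal.cancel_of_ne hc).tsub_add_eq_add_tsub (hV hx) |>.symm
    rw [this]
  intro A hA
  have h1 := key _ MeasurableSet.univ
  rw [Set.preimage_univ, Set.inter_univ, measure_univ, mul_one] at h1
  rw [key A hA, h1]

/-! ### One race between independent clocks -/

theorem argminBelow_nonempty {N : ℕ} (hN : 0 < N) (f : ℕ → ℝ≥0∞) :
    {v | v < N ∧ ∀ w < N, f v ≤ f w}.Nonempty := by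
  obtain ⟨v, hv, h⟩ := Finset.exists_min_image (Finset.range N) f ⟨0, by simpa using hN⟩
  exact ⟨v, by simpa using hv, fun w hw => h w (by simpa using hw)⟩

theorem argminBelow_lt {N : ℕ} (hN : 0 < N) (f : ℕ → ℝ≥0∞) : argminBelow N f < N :=
  (Nat.sInf_mem (argminBelow_nonempty hN f)).1

theorem apply_argminBelow_le {N : ℕ} (f : ℕ → ℝ≥0∞) {w : ℕ} (hw : w < N) :
    f (argminBelow N f) ≤ f w :=
  (Nat.sInf_mem (argminBelow_nonempty (by omega) f)).2 w hw

/-- The least minimiser wins, hence strict inequality against smaller indices and weak inequality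
against larger ones. -/
theorem argminBelow_eq_iff {N j : ℕ} (hj : j < N) (f : ℕ → ℝ≥0∞) :
    argminBelow N f = j ↔ ∀ w < N, w ≠ j → if w < j then f j < f w else f j ≤ f w := by
  constructor
  · rintro rfl w hw _
    split_ifs with h
    · by_contra hlt
      exact Nat.notMem_of_lt_sInf h
        ⟨hw, fun u hu => (not_lt.1 hlt).trans (apply_argminBelow_le f hu)⟩
    · exact apply_argminBelow_le f hw
  · intro h
    have hle : ∀ w < N, f j ≤ f w := fun w hw => by
      rcases eq_or_ne w j with rfl | hwj
      · exact le_rfl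
      · have := h w hw hwj
        split_ifs at this
        exacts [this.le, this]
    refine le_antisymm (Nat.sInf_le ⟨hj, hle⟩) (not_lt.1 fun hlt => ?_)
    have h1 := h _ (argminBelow_lt (by omega) f) hlt.ne
    rw [if_pos hlt] at h1
    exact absurd (apply_argminBelow_le f hj) (not_le.2 h1)

theorem argminBelow_congr {N : ℕ} {f g : ℕ → ℝ≥0∞} (h : ∀ v < N, f v = g v) :
    argminBelow N f = argminBelow N g := by
  unfold argminBelow
  congr 1
  ext v
  refine and_congr_right fun hv => forall₂_congr fun w hw => ?_
  rw [h v hv, h w hw]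

theorem measurable_argminBelow (N : ℕ) : Measurable (argminBelow N) := by
  refine measurable_to_countable' fun j => ?_
  rcases Nat.eq_zero_or_pos N with rfl | hN
  · have : argminBelow 0 = fun _ => 0 := by
      ext f
      simp [argminBelow]
    rw [this]
    exact measurable_const (measurableSet_singleton j)
  by_cases hj : j < N
  · have e : argminBelow N ⁻¹' {j} =
        ⋂ w, {f | w < N → w ≠ j → if w < j then f j < f w else f j ≤ f w} := by
      ext f
      simp [argminBelow_eq_iff hj]
    have hm : ∀ v, Measurable fun f : ℕ → ℝ≥0∞ => f v := measurable_pi_apply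
    rw [e]
    refine MeasurableSet.iInter fun w => ?_
    by_cases h1 : w < N ∧ w ≠ j
    swap
    · convert MeasurableSet.univ
      ext f
      simp only [Set.mem_ofPred_eq, Set.mem_univ, iff_true]
      exact fun h h' => absurd ⟨h, h'⟩ h1
    simp only [h1, ne_eq, not_false_eq_true, forall_true_left]
    split_ifs
    · exact measurableSet_lt (hm j) (hm w)
    · exact measurableSet_le (hm j) (hm w)
  · have e : argminBelow N ⁻¹' {j} = ∅ := by
      ext f
      have := argminBelow_lt hN f
      simp only [Set.mem_preimage, Set.mem_singleton_iff, Set.mem_empty_iff_false, iff_false]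
      omega
    rw [e]
    exact MeasurableSet.empty

/-- The node whose process jumps first. -/
noncomputable def firstToJump (N : ℕ) (R : ℕ → ℕ → ℝ≥0∞) : ℕ := argminBelow N fun v => R v 0

theorem measurable_firstToJump (N : ℕ) : Measurable (firstToJump N) :=
  (measurable_argminBelow N).comp <| measurable_pi_iff.2 fun v =>
    (measurable_pi_apply 0).comp (measurable_pi_apply v)

/-- The waiting times after the first jump, when node `j` jumps first among the nodes `v < N`. -/
noncomputable def advance (N j : ℕ) (R : ℕ → ℕ → ℝ≥0∞) (v i : ℕ) : ℝ≥0∞ :=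
  if v < N then R v (if v = j then i + 1 else i) - R j 0 else R v i

theorem measurable_advance (N j : ℕ) : Measurable (advance N j) := by
  have h : ∀ v i, Measurable fun R : ℕ → ℕ → ℝ≥0∞ => R v i := fun v i =>
    (measurable_pi_apply i).comp (measurable_pi_apply v)
  refine measurable_pi_iff.2 fun v => measurable_pi_iff.2 fun i => ?_
  unfold advance
  by_cases hv : v < N
  · simp only [hv, if_true]
    exact (h _ _).sub (h _ _)
  · simp only [hv, if_false]
    exact h _ _

/-- The law of the waiting times of independent birth-immigration processes in states `k v`. -/
noncomputable def raceLaw (ρ : ℕ → ℝ≥0) (k : ℕ → ℕ) : Measure (ℕ → ℕ → ℝ≥0∞) :=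
  Measure.infinitePi fun v => rowLaw (ρ v) (k v)

instance isProbabilityMeasure_raceLaw (ρ : ℕ → ℝ≥0) (k : ℕ → ℕ) :
    IsProbabilityMeasure (raceLaw ρ k) := by
  unfold raceLaw
  infer_instance

theorem raceLaw_map_zero (ρ : ℕ → ℝ≥0) (k : ℕ → ℕ) (v : ℕ) :
    (raceLaw ρ k).map (fun R => R v 0) = clockLaw (k v + ρ v) := by
  rw [← rowLaw_map_zero, ← Measure.infinitePi_map_eval (fun v => rowLaw (ρ v) (k v)) v,
    Measure.map_map (measurable_pi_apply 0) (measurable_pi_apply v)]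
  rfl

theorem ae_raceLaw_pos (ρ : ℕ → ℝ≥0) (k : ℕ → ℕ) : ∀ᵐ R ∂raceLaw ρ k, ∀ v, 0 < R v 0 := by
  refine ae_all_iff.2 fun v => ?_
  have h := clockLaw_singleton (k v + ρ v) ENNReal.zero_ne_top
  have hm : Measurable fun R : ℕ → ℕ → ℝ≥0∞ => R v 0 :=
    (measurable_pi_apply 0).comp (measurable_pi_apply v)
  rw [← raceLaw_map_zero, Measure.map_apply hm (measurableSet_singleton _)] at h
  rw [ae_iff]
  convert h using 2
  ext R
  simp

theorem ae_raceLaw_ne_top {ρ : ℕ → ℝ≥0} {v : ℕ} (hρ : ρ v ≠ 0) (k : ℕ → ℕ) :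
    ∀ᵐ R ∂raceLaw ρ k, R v 0 ≠ ∞ := by
  have h := clockLaw_singleton_top (r := k v + ρ v) (by positivity)
  have hm : Measurable fun R : ℕ → ℕ → ℝ≥0∞ => R v 0 :=
    (measurable_pi_apply 0).comp (measurable_pi_apply v)
  rw [← raceLaw_map_zero, Measure.map_apply hm (measurableSet_singleton _)] at h
  rw [ae_iff]
  convert h using 2
  ext R
  simp

/-- The first jump: the node that jumps is independent of the waiting times that follow the jump,
and these are distributed as for independent processes in the new states. -/
theorem raceLaw_firstToJump_inter_advance {ρ : ℕ → ℝ≥0} (hρ : ρ 0 ≠ 0) (k : ℕ → ℕ) {N : ℕ}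
    (hN : 0 < N) (j : ℕ) {A : Set (ℕ → ℕ → ℝ≥0∞)} (hA : MeasurableSet A) :
    raceLaw ρ k (firstToJump N ⁻¹' {j} ∩ advance N j ⁻¹' A) =
      raceLaw ρ k (firstToJump N ⁻¹' {j}) * raceLaw ρ (k + Pi.single j 1) A := by
  by_cases hj : j < N
  swap
  · have e : firstToJump N ⁻¹' {j} = ∅ := by
      ext R
      have := argminBelow_lt hN fun v => R v 0
      simp only [firstToJump, Set.mem_preimage, Set.mem_singleton_iff, Set.mem_empty_iff_false,
        iff_false]
      omega
    simp [e]
  set k' := k + Pi.single j 1 with hk'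
  set ν := clockLaw (k j + ρ j)
  have hmc : Measurable fun p : ℝ≥0∞ × (ℕ → ℕ → ℝ≥0∞) =>
      Function.update p.2 j (consRow p.1 (p.2 j)) := by
    refine measurable_pi_iff.2 fun v => ?_
    by_cases hv : v = j
    · subst hv
      simp only [Function.update_self]
      exact measurable_consRow.comp
        (measurable_fst.prodMk ((measurable_pi_apply _).comp measurable_snd))
    · simp only [Function.update_of_ne hv]
      exact (measurable_pi_apply _).comp measurable_snd
  -- Row `j` is decomposed into its first waiting time `x` and a row of a process already in the
  -- next state. With `x` held fixed, the event that `j` wins constrains only the other rows.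
  have hsplit : (ν.prod (raceLaw ρ k')).map
      (fun p => Function.update p.2 j (consRow p.1 (p.2 j))) = raceLaw ρ k := by
    refine infinitePi_map_replace j (fun i hi => by simp [hk', hi]) measurable_consRow ?_
    simpa [hk'] using map_consRow (ρ j) (k j)
  have hmW : MeasurableSet (firstToJump N ⁻¹' {j}) :=
    measurable_firstToJump N (measurableSet_singleton j)
  have hmA := hmW.inter (measurable_advance N j hA)
  have hrow : ∀ x : ℝ≥0∞, ∀ F : ℕ → ℕ → ℝ≥0∞,
      Function.update F j (consRow x (F j)) ∈ firstToJump N ⁻¹' {j} ↔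
        ∀ w < N, w ≠ j → if w < j then x < F w 0 else x ≤ F w 0 := by
    intro x F
    rw [Set.mem_preimage, Set.mem_singleton_iff, firstToJump, argminBelow_eq_iff hj]
    refine forall₃_congr fun w _ hwj => ?_
    simp [Function.update_of_ne hwj, consRow]
  let G : ℝ≥0∞ → Set (ℕ → ℕ → ℝ≥0∞) := fun x =>
    {F | Function.update F j (consRow x (F j)) ∈ firstToJump N ⁻¹' {j}}
  have hfin : ∀ x ≠ ∞, raceLaw ρ k' (G x ∩
      {F | advance N j (Function.update F j (consRow x (F j))) ∈ A}) =
        raceLaw ρ k' (G x) * raceLaw ρ k' A := by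
    intro x hx
    -- The competitors of `j` must ring after `x` and are then shifted by `x`; row `j` is left
    -- alone, since its shift by `x` is undone by removing `x` from `consRow`.
    let V : ℕ → Set (ℕ → ℝ≥0∞) := fun v =>
      if v < N ∧ v ≠ j then {R | R 0 ∈ (if v < j then Set.Ioi x else Set.Ici x)} else Set.univ
    let φ : ℕ → (ℕ → ℝ≥0∞) → ℕ → ℝ≥0∞ := fun v =>
      if v < N ∧ v ≠ j then fun R i => R i - x else id
    have hreg := RegeneratesOn.infinitePi (M := fun v => rowLaw (ρ v) (k' v)) (V := V) (φ := φ)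
      (Finset.range N) (fun v => ?_) (fun v => ?_) (fun v => ?_) (fun v hv => ?_)
    · have e1 : G x = Set.pi (Finset.range N : Set ℕ) V := by
        ext F
        simp only [G, Set.mem_ofPred_eq, hrow, Set.mem_pi, Finset.mem_coe, Finset.mem_range, V]
        refine forall₂_congr fun w hw => ?_
        by_cases hwj : w = j
        · simp [hwj]
        · by_cases hlt : w < j <;> simp [hw, hwj, hlt]
      have e2 : {F | advance N j (Function.update F j (consRow x (F j))) ∈ A} =
          (fun F v => φ v (F v)) ⁻¹' A := by
        ext F
        simp only [Set.mem_ofPred_eq, Set.mem_preimage]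
        suffices advance N j (Function.update F j (consRow x (F j))) = fun v => φ v (F v) by
          rw [this]
        ext v i
        simp only [advance, Function.update_self, φ, consRow]
        by_cases hv : v < N
        · by_cases hvj : v = j
          · subst hvj
            simp [hv, consRow, ENNReal.add_sub_cancel_left hx]
          · simp [hv, hvj, Function.update_of_ne]
        · have : v ≠ j := by omega
          simp [hv, Function.update_of_ne this]
      rw [e1, e2]
      exact hreg A hA
    · simp only [V]
      split_ifs
      · exact (measurable_pi_apply 0) measurableSet_Ioi
      · exact (measurable_pi_apply 0) measurableSet_Ici
      · exact MeasurableSet.univ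
    · simp only [φ]
      split_ifs
      · exact measurable_pi_iff.2 fun i => (measurable_ennreal_sub_const x).comp (measurable_pi_apply i)
      · exact measurable_id
    · simp only [V, φ]
      split_ifs
      · exact rowLaw_regeneratesOn _ _ hx measurableSet_Ioi Set.Ioi_subset_Ici_self
          (regeneratesOn_clockLaw_Ioi _ hx)
      · exact rowLaw_regeneratesOn _ _ hx measurableSet_Ici subset_rfl
          (regeneratesOn_clockLaw_Ici _ hx)
      · exact RegeneratesOn.id _
    · simp only [V]
      rw [if_neg fun h => hv (Finset.mem_range.2 h.1)]
  have hae : ∀ᵐ x ∂ν, raceLaw ρ k' (G x ∩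
      {F | advance N j (Function.update F j (consRow x (F j))) ∈ A}) =
        raceLaw ρ k' (G x) * raceLaw ρ k' A := by
    rcases eq_or_ne j 0 with rfl | hj0
    · have : ∀ᵐ x ∂ν, x ≠ ∞ := by
        rw [ae_iff]
        simpa using clockLaw_singleton_top (r := k 0 + ρ 0) (by positivity)
      filter_upwards [this] with x hx using hfin x hx
    · refine Filter.Eventually.of_forall fun x => ?_
      rcases eq_or_ne x ∞ with rfl | hx
      · have h0 : raceLaw ρ k' (G ∞) = 0 := by
          have := ae_raceLaw_ne_top hρ k'
          rw [ae_iff] at this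
          refine measure_mono_null (fun F hF => ?_) this
          have := (hrow ∞ F).1 hF 0 hN hj0.symm
          rw [if_pos (Nat.pos_of_ne_zero hj0)] at this
          exact absurd this not_top_lt
        rw [h0, zero_mul]
        exact measure_mono_null Set.inter_subset_left h0
      · exact hfin x hx
  have hG : Measurable fun x => raceLaw ρ k' (G x) := measurable_measure_prodMk_left (hmc hmW)
  rw [← hsplit, Measure.map_apply hmc hmA, Measure.map_apply hmc hmW,
    Measure.prod_apply (hmc hmA), Measure.prod_apply (hmc hmW)]
  exact (lintegral_congr_ae hae).trans (lintegral_mul_const _ hG)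

/-! ### Laws of sequences with values in a countable set -/

theorem exists_list_getD_eq {α : Type*} (f : ℕ → α) (d : α) (n : ℕ) :
    ∃ l : List α, ∀ m < n, l.getD m d = f m :=
  ⟨(List.range n).map f, fun m hm => by simp [List.getD_eq_getElem?_getD, hm]⟩

/-- Finite histories take countably many values, so the cylinders over single histories already
generate the product σ-algebra, and they form a π-system. -/
theorem measure_ext_of_cylinder {μ ν : Measure (ℕ → ℕ)} [IsProbabilityMeasure μ]
    [IsProbabilityMeasure ν]
    (h : ∀ (a : ℕ → ℕ) (n : ℕ), μ {f | ∀ m < n, f m = a m} = ν {f | ∀ m < n, f m = a m}) :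
    μ = ν := by
  let C : Set (Set (ℕ → ℕ)) := {s | ∃ (a : ℕ → ℕ) (n : ℕ), s = {f | ∀ m < n, f m = a m}}
  have hle : (MeasurableSpace.pi : MeasurableSpace (ℕ → ℕ)) ≤ MeasurableSpace.generateFrom C := by
    refine iSup_le fun i => ?_
    rw [← measurable_iff_comap_le]
    refine @measurable_to_countable' _ _ _ _ (MeasurableSpace.generateFrom C) _ fun c => ?_
    have e : (fun f : ℕ → ℕ => f i) ⁻¹' {c} =
        ⋃ (l : List ℕ) (_ : l.getD i 0 = c), {f | ∀ m < i + 1, f m = l.getD m 0} := by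
      ext f
      simp only [Set.mem_preimage, Set.mem_singleton_iff, Set.mem_iUnion, Set.mem_ofPred_eq,
        exists_prop]
      constructor
      · intro hf
        obtain ⟨l, hl⟩ := exists_list_getD_eq f 0 (i + 1)
        exact ⟨l, by rw [hl i (by omega), hf], fun m hm => (hl m hm).symm⟩
      · rintro ⟨l, hl, hf⟩
        rw [hf i (by omega), hl]
    rw [e]
    exact MeasurableSet.iUnion fun l => MeasurableSet.iUnion fun _ =>
      MeasurableSpace.measurableSet_generateFrom ⟨_, _, rfl⟩
  have hge : MeasurableSpace.generateFrom C ≤ (MeasurableSpace.pi : MeasurableSpace (ℕ → ℕ)) := by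
    refine MeasurableSpace.generateFrom_le ?_
    rintro _ ⟨a, n, rfl⟩
    have e : {f : ℕ → ℕ | ∀ m < n, f m = a m} =
        Set.pi (Finset.range n : Set ℕ) fun m => {a m} := by
      ext f
      simp
    rw [e]
    exact MeasurableSet.pi (Finset.countable_toSet _) fun m _ => measurableSet_singleton _
  refine ext_of_generate_finite C (le_antisymm hle hge) ?_ ?_ (by simp)
  -- Two cylinders with a common point `f` intersect in the longer cylinder along `f`.
  · rintro _ ⟨a, n, rfl⟩ _ ⟨a', n', rfl⟩ ⟨f, hf, hf'⟩
    refine ⟨f, max n n', ?_⟩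
    ext g
    simp only [Set.mem_inter_iff, Set.mem_ofPred_eq, lt_max_iff] at hf hf' ⊢
    constructor
    · rintro ⟨h1, h2⟩ m (hm | hm)
      · rw [h1 m hm, hf m hm]
      · rw [h2 m hm, hf' m hm]
    · intro hg
      exact ⟨fun m hm => by rw [hg m (Or.inl hm), hf m hm],
        fun m hm => by rw [hg m (Or.inr hm), hf' m hm]⟩
  · rintro _ ⟨a, n, rfl⟩
    exact h a n

/-! ### The sequence of winners, for independent birth-immigration processes -/

/-- The number of times that each node is chosen in the active ones among the first `n` steps. -/
def counts (act : ℕ → Bool) (j : ℕ → ℕ) : ℕ → ℕ → ℕ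
  | 0 => 0
  | n + 1 => if act n then counts act j n + Pi.single (j n) 1 else counts act j n

/-- The waiting times after `n` steps, when step `n` is a race between the nodes `v < N n` if
`act n`, and otherwise changes nothing. -/
noncomputable def raceState (N : ℕ → ℕ) (act : ℕ → Bool) (R : ℕ → ℕ → ℝ≥0∞) : ℕ → ℕ → ℕ → ℝ≥0∞
  | 0 => R
  | n + 1 =>
    if act n then advance (N n) (firstToJump (N n) (raceState N act R n)) (raceState N act R n)
    else raceState N act R n

/-- In an inactive step the value `0` is a placeholder, ignored by `counts`; the factor `stepProb`
is then the point mass at `0`. -/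
noncomputable def raceWinner (N : ℕ → ℕ) (act : ℕ → Bool) (R : ℕ → ℕ → ℝ≥0∞) (n : ℕ) : ℕ :=
  if act n then firstToJump (N n) (raceState N act R n) else 0

theorem counts_congr {act act' : ℕ → Bool} {j j' : ℕ → ℕ} {n : ℕ}
    (h : ∀ m < n, act m = act' m) (hj : ∀ m < n, j m = j' m) :
    counts act j n = counts act' j' n := by
  induction n with
  | zero => rfl
  | succ n ih =>
    rw [counts, counts, ih (fun m hm => h m (by omega)) (fun m hm => hj m (by omega)),
      h n (by omega), hj n (by omega)]

theorem raceState_congr {N N' : ℕ → ℕ} {act act' : ℕ → Bool} (R : ℕ → ℕ → ℝ≥0∞) {n : ℕ}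
    (hN : ∀ m < n, N m = N' m) (h : ∀ m < n, act m = act' m) :
    raceState N act R n = raceState N' act' R n := by
  induction n with
  | zero => rfl
  | succ n ih =>
    rw [raceState, raceState, ih (fun m hm => hN m (by omega)) (fun m hm => h m (by omega)),
      h n (by omega), hN n (by omega)]

theorem measurable_raceState (N : ℕ → ℕ) (act : ℕ → Bool) (n : ℕ) :
    Measurable fun R => raceState N act R n := by
  induction n with
  | zero => exact measurable_id
  | succ n ih =>
    simp only [raceState]
    cases act n
    · exact ih
    · have : Measurable fun p : (ℕ → ℕ → ℝ≥0∞) × ℕ => advance (N n) p.2 p.1 :=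
        measurable_from_prod_countable_left fun j => measurable_advance (N n) j
      exact this.comp (ih.prodMk ((measurable_firstToJump _).comp ih))

theorem measurable_raceWinner (N : ℕ → ℕ) (act : ℕ → Bool) : Measurable (raceWinner N act) := by
  refine measurable_pi_iff.2 fun n => ?_
  unfold raceWinner
  cases act n
  · exact measurable_const
  · exact (measurable_firstToJump _).comp (measurable_raceState N act n)

/-- The probability that node `a n` is chosen in step `n`, given the nodes `a m`, `m < n`, chosen
before. -/
noncomputable def stepProb (ρ : ℕ → ℝ≥0) (N : ℕ → ℕ) (act : ℕ → Bool) (a : ℕ → ℕ) (n : ℕ) :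
    ℝ≥0∞ :=
  if act n then raceLaw ρ (counts act a n) (firstToJump (N n) ⁻¹' {a n}) else if a n = 0 then 1 else 0

/-- The winners of the first `n` races, and the waiting times after these races. -/
theorem raceLaw_raceWinner_inter_raceState {ρ : ℕ → ℝ≥0} (hρ : ρ 0 ≠ 0) {N : ℕ → ℕ}
    (hN : ∀ n, 0 < N n) (act : ℕ → Bool) (a : ℕ → ℕ) (n : ℕ) {A : Set (ℕ → ℕ → ℝ≥0∞)}
    (hA : MeasurableSet A) :
    raceLaw ρ 0 {R | (∀ m < n, raceWinner N act R m = a m) ∧ raceState N act R n ∈ A} =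
      (∏ m ∈ Finset.range n, stepProb ρ N act a m) * raceLaw ρ (counts act a n) A := by
  induction n generalizing A with
  | zero => simp [raceState, counts]
  | succ n ih =>
    rw [Finset.prod_range_succ, mul_assoc]
    by_cases hact : act n = true
    · have h1 : stepProb ρ N act a n * raceLaw ρ (counts act a (n + 1)) A =
          raceLaw ρ (counts act a n) (firstToJump (N n) ⁻¹' {a n} ∩ advance (N n) (a n) ⁻¹' A) := by
        rw [raceLaw_firstToJump_inter_advance hρ _ (hN n) _ hA]
        simp [stepProb, counts, hact]
      rw [h1, ← ih ((measurable_firstToJump _ (measurableSet_singleton _)).inter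
        (measurable_advance _ _ hA))]
      congr 1
      ext R
      simp only [Set.mem_ofPred_eq, Nat.forall_lt_succ_right, and_assoc, Set.mem_inter_iff,
        Set.mem_preimage, Set.mem_singleton_iff]
      refine and_congr_right fun _ => ?_
      simp only [raceWinner, raceState, hact, if_true]
      refine and_congr_right fun h => ?_
      rw [h]
    · have hc : counts act a (n + 1) = counts act a n := by simp [counts, hact]
      have hw : ∀ R, raceWinner N act R n = 0 := fun R => by simp [raceWinner, hact]
      have hs : ∀ R, raceState N act R (n + 1) = raceState N act R n := fun R => by
        simp [raceState, hact]
      rw [hc]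
      by_cases ha : a n = 0
      · have h1 : stepProb ρ N act a n = 1 := by simp [stepProb, hact, ha]
        rw [h1, one_mul, ← ih hA]
        congr 1
        ext R
        simp only [Set.mem_ofPred_eq, Nat.forall_lt_succ_right, hw, hs, ha, and_true]
      · have h1 : stepProb ρ N act a n = 0 := by simp [stepProb, hact, ha]
        rw [h1, zero_mul, mul_zero]
        convert measure_empty (μ := raceLaw ρ 0)
        ext R
        simp only [Set.mem_ofPred_eq, Nat.forall_lt_succ_right, hw, Ne.symm ha, and_false, false_and,
          Set.mem_empty_iff_false]

theorem raceLaw_raceWinner {ρ : ℕ → ℝ≥0} (hρ : ρ 0 ≠ 0) {N : ℕ → ℕ}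
    (hN : ∀ n, 0 < N n) (act : ℕ → Bool) (a : ℕ → ℕ) (n : ℕ) :
    raceLaw ρ 0 {R | ∀ m < n, raceWinner N act R m = a m} =
      ∏ m ∈ Finset.range n, stepProb ρ N act a m := by
  simpa using raceLaw_raceWinner_inter_raceState hρ hN act a n MeasurableSet.univ

/-- Given any of the countably many possible histories of winners, the state after `n` steps has
some law `raceLaw ρ k`, so a property that is almost sure under all these laws holds for the state.
As `p` need not be measurable, its failure set is covered by `toMeasurable`. -/
theorem ae_raceState_mem {ρ : ℕ → ℝ≥0} (hρ : ρ 0 ≠ 0) {N : ℕ → ℕ}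
    (hN : ∀ n, 0 < N n) (act : ℕ → Bool) {p : (ℕ → ℕ → ℝ≥0∞) → Prop}
    (hp : ∀ k, ∀ᵐ R ∂raceLaw ρ k, p R) (n : ℕ) :
    ∀ᵐ R ∂raceLaw ρ 0, p (raceState N act R n) := by
  have hnull : ∀ l : List ℕ, raceLaw ρ 0 {R | (∀ m < n, raceWinner N act R m = l.getD m 0) ∧
      raceState N act R n ∈ toMeasurable (raceLaw ρ (counts act (fun m => l.getD m 0) n))
        {R | ¬ p R}} = 0 := fun l => by
    rw [raceLaw_raceWinner_inter_raceState hρ hN act (fun m => l.getD m 0) n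
      (measurableSet_toMeasurable _ _), measure_toMeasurable, ae_iff.1 (hp _), mul_zero]
  rw [ae_iff]
  refine measure_mono_null (fun R hR => ?_) (measure_iUnion_null hnull)
  obtain ⟨l, hl⟩ := exists_list_getD_eq (raceWinner N act R) 0 n
  exact Set.mem_iUnion.2 ⟨l, fun m hm => (hl m hm).symm, subset_toMeasurable _ _ hR⟩

/-! ### The sequence of winners, for fresh exponential variables in each step -/

/-- The number of times that each node has been chosen before step `n`, if in each active step the
node whose clock rings first is chosen. -/
noncomputable def urn (ρ : ℕ → ℝ≥0) (N : ℕ → ℕ) (act : ℕ → Bool) (τ : ℕ → ℕ → ℝ) : ℕ → ℕ → ℕ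
  | 0 => 0
  | n + 1 =>
    if act n then
      urn ρ N act τ n + Pi.single
        (argminBelow (N n) fun v => ENNReal.ofReal (τ n v) / (urn ρ N act τ n v + ρ v : ℝ≥0)) 1
    else urn ρ N act τ n

noncomputable def urnWinner (ρ : ℕ → ℝ≥0) (N : ℕ → ℕ) (act : ℕ → Bool) (τ : ℕ → ℕ → ℝ) (n : ℕ) :
    ℕ :=
  if act n then
    argminBelow (N n) fun v => ENNReal.ofReal (τ n v) / (urn ρ N act τ n v + ρ v : ℝ≥0)
  else 0

theorem urn_eq_counts (ρ : ℕ → ℝ≥0) (N : ℕ → ℕ) (act : ℕ → Bool) (τ : ℕ → ℕ → ℝ) (n : ℕ) :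
    urn ρ N act τ n = counts act (urnWinner ρ N act τ) n := by
  induction n with
  | zero => rfl
  | succ n ih =>
    rw [urn, counts, urnWinner, ← ih]
    split_ifs <;> rfl

theorem urn_congr (ρ : ℕ → ℝ≥0) {N N' : ℕ → ℕ} {act act' : ℕ → Bool} (τ : ℕ → ℕ → ℝ) {n : ℕ}
    (hN : ∀ m < n, N m = N' m) (h : ∀ m < n, act m = act' m) :
    urn ρ N act τ n = urn ρ N' act' τ n := by
  induction n with
  | zero => rfl
  | succ n ih =>
    rw [urn, urn, ih (fun m hm => hN m (by omega)) (fun m hm => h m (by omega)),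
      h n (by omega), hN n (by omega)]

theorem measurable_clocks (ρ : ℕ → ℝ≥0) (k : ℕ → ℕ) :
    Measurable fun (t : ℕ → ℝ) v => ENNReal.ofReal (t v) / (k v + ρ v : ℝ≥0) :=
  measurable_pi_iff.2 fun v => (measurable_ofReal_div _).comp (measurable_pi_apply v)

/-- The winner depends only on the first entries of the rows, and these are independent clocks of
rates `k v + ρ v`, exactly like the fresh clocks. -/
theorem infinitePi_argminBelow (ρ : ℕ → ℝ≥0) (k : ℕ → ℕ) (N j : ℕ) :
    (Measure.infinitePi fun _ : ℕ => expMeasure 1)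
      {t | argminBelow N (fun v => ENNReal.ofReal (t v) / (k v + ρ v : ℝ≥0)) = j} =
      raceLaw ρ k (firstToJump N ⁻¹' {j}) := by
  have hm : ∀ _ : ℕ, Measurable fun R : ℕ → ℝ≥0∞ => R 0 := fun _ => measurable_pi_apply 0
  have hm' : Measurable fun (R : ℕ → ℕ → ℝ≥0∞) v => R v 0 :=
    measurable_pi_iff.2 fun v => (measurable_pi_apply 0).comp (measurable_pi_apply v)
  have h : (Measure.infinitePi fun _ : ℕ => expMeasure 1).map
      (fun (t : ℕ → ℝ) v => ENNReal.ofReal (t v) / (k v + ρ v : ℝ≥0)) =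
        (raceLaw ρ k).map fun R v => R v 0 := by
    rw [raceLaw, Measure.infinitePi_map_pi (fun v => rowLaw (ρ v) (k v)) hm,
      Measure.infinitePi_map_pi (fun _ : ℕ => expMeasure 1)
        (f := fun v x => ENNReal.ofReal x / (k v + ρ v : ℝ≥0)) fun v => measurable_ofReal_div _]
    congr 1
    ext1 v
    exact (rowLaw_map_zero _ _).symm
  have hj := measurable_argminBelow N (measurableSet_singleton j)
  have := congrArg (fun m => m (argminBelow N ⁻¹' {j})) h
  rw [Measure.map_apply (measurable_clocks ρ k) hj, Measure.map_apply hm' hj] at this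
  exact this

/-- Along a prescribed history `a` the rates in step `m` are deterministic, so the event is a
rectangle with one condition on each row `τ m`. -/
theorem infinitePi_urnWinner (ρ : ℕ → ℝ≥0) (N : ℕ → ℕ) (act : ℕ → Bool) (a : ℕ → ℕ) (n : ℕ) :
    (Measure.infinitePi fun _ : ℕ => Measure.infinitePi fun _ : ℕ => expMeasure 1)
      {τ | ∀ m < n, urnWinner ρ N act τ m = a m} = ∏ m ∈ Finset.range n, stepProb ρ N act a m := by
  let A : ℕ → Set (ℕ → ℝ) := fun m => if act m then
    {t | argminBelow (N m) (fun v => ENNReal.ofReal (t v) / (counts act a m v + ρ v : ℝ≥0)) = a m}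
    else if a m = 0 then Set.univ else ∅
  have e : {τ | ∀ m < n, urnWinner ρ N act τ m = a m} = Set.pi (Finset.range n : Set ℕ) A := by
    ext τ
    simp only [Set.mem_ofPred_eq, Set.mem_pi, Finset.mem_coe, Finset.mem_range]
    induction n with
    | zero => simp
    | succ n ih =>
      rw [Nat.forall_lt_succ_right, Nat.forall_lt_succ_right, ih]
      refine and_congr_right fun h => ?_
      have hc : urn ρ N act τ n = counts act a n := by
        rw [urn_eq_counts]
        exact counts_congr (fun _ _ => rfl) (ih.2 h)
      simp only [urnWinner, A, hc]
      split_ifs with h1 h2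
      · rfl
      · simp [h2]
      · simp [Ne.symm h2]
  have hA : ∀ m, MeasurableSet (A m) := fun m => by
    simp only [A]
    split_ifs
    · exact (measurable_argminBelow _).comp (measurable_clocks ρ _) (measurableSet_singleton _)
    · exact MeasurableSet.univ
    · exact MeasurableSet.empty
  rw [e, Measure.infinitePi_pi _ fun m _ => hA m]
  refine Finset.prod_congr rfl fun m _ => ?_
  simp only [A, stepProb]
  split_ifs
  · exact infinitePi_argminBelow ρ _ _ _
  · exact measure_univ
  · exact measure_empty

theorem measurable_urn (ρ : ℕ → ℝ≥0) (N : ℕ → ℕ) (act : ℕ → Bool) (n : ℕ) :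
    Measurable fun τ => urn ρ N act τ n := by
  induction n with
  | zero => exact measurable_const
  | succ n ih =>
    simp only [urn]
    cases act n
    · exact ih
    · refine ih.add ?_
      have hs : Measurable fun j : ℕ => (Pi.single j 1 : ℕ → ℕ) := measurable_from_top
      refine hs.comp ((measurable_argminBelow _).comp (measurable_pi_iff.2 fun v => ?_))
      have hv : Measurable fun τ => urn ρ N act τ n v := (measurable_pi_apply v).comp ih
      have hτ : Measurable fun τ : ℕ → ℕ → ℝ => τ n v :=
        (measurable_pi_apply v).comp (measurable_pi_apply n)
      have hk : Measurable fun k : ℕ => ((k + ρ v : ℝ≥0) : ℝ≥0∞) := measurable_from_top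
      exact hτ.ennreal_ofReal.div (hk.comp hv)

theorem measurable_urnWinner (ρ : ℕ → ℝ≥0) (N : ℕ → ℕ) (act : ℕ → Bool) :
    Measurable (urnWinner ρ N act) := by
  refine measurable_pi_iff.2 fun n => ?_
  unfold urnWinner
  cases act n
  · exact measurable_const
  · refine (measurable_argminBelow _).comp (measurable_pi_iff.2 fun v => ?_)
    have hv : Measurable fun τ => urn ρ N act τ n v :=
      (measurable_pi_apply v).comp (measurable_urn ρ N act n)
    have hτ : Measurable fun τ : ℕ → ℕ → ℝ => τ n v :=
      (measurable_pi_apply v).comp (measurable_pi_apply n)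
    have hk : Measurable fun k : ℕ => ((k + ρ v : ℝ≥0) : ℝ≥0∞) := measurable_from_top
    exact hτ.ennreal_ofReal.div (hk.comp hv)

/-- The nodes chosen with fresh exponential variables in each step have the same law as the nodes
chosen by independent birth-immigration processes. -/
theorem map_urnWinner_eq {ρ : ℕ → ℝ≥0} (hρ : ρ 0 ≠ 0) {N : ℕ → ℕ} (hN : ∀ n, 0 < N n)
    (act : ℕ → Bool) :
    (Measure.infinitePi fun _ : ℕ => Measure.infinitePi fun _ : ℕ => expMeasure 1).map
      (urnWinner ρ N act) = (raceLaw ρ 0).map (raceWinner N act) := by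
  have := Measure.isProbabilityMeasure_map (μ := Measure.infinitePi fun _ : ℕ =>
    Measure.infinitePi fun _ : ℕ => expMeasure 1) (measurable_urnWinner ρ N act).aemeasurable
  have := Measure.isProbabilityMeasure_map (μ := raceLaw ρ 0)
    (measurable_raceWinner N act).aemeasurable
  refine measure_ext_of_cylinder fun a n => ?_
  have hm : MeasurableSet {f : ℕ → ℕ | ∀ m < n, f m = a m} := by
    have e : {f : ℕ → ℕ | ∀ m < n, f m = a m} =
        Set.pi (Finset.range n : Set ℕ) fun m => {a m} := by
      ext f
      simp
    rw [e]
    exact MeasurableSet.pi (Finset.countable_toSet _) fun m _ => measurableSet_singleton _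
  rw [Measure.map_apply (measurable_urnWinner ρ N act) hm,
    Measure.map_apply (measurable_raceWinner N act) hm]
  exact (infinitePi_urnWinner ρ N act a n).trans (raceLaw_raceWinner hρ hN act a n).symm

/-! ### Counting paths and their hitting times -/

/-- A right-continuous path in a discrete space is constant on some `[t, u)`, so the infimum
defining the hitting time is attained when finite. -/
theorem le_iff_hittingTime_le {x : ℝ≥0 → ℕ} (hx : Monotone x)
    (hr : ∀ t, ContinuousWithinAt x (Set.Ici t) t) (k : ℕ) (t : ℝ≥0) :
    k ≤ x t ↔ hittingTime x k ≤ t := by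
  refine ⟨fun h => iInf₂_le t h, fun h => ?_⟩
  by_contra hk
  have hev : ∀ᶠ s in nhdsWithin t (Set.Ici t), x s = x t := by
    have := hr t
    rw [ContinuousWithinAt, nhds_discrete, Filter.tendsto_pure] at this
    exact this
  obtain ⟨u, hu, hsub⟩ := (mem_nhdsGE_iff_exists_Ico_subset (a := t)).1 hev
  have hlt : (t : ℝ≥0∞) < u := by exact_mod_cast hu
  refine absurd (h.trans_lt hlt) (not_lt.2 (le_iInf₂ fun s hs => ?_))
  have : u ≤ s := by
    by_contra hsu
    rcases le_total s t with hst | hts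
    · exact hk (hs.trans (hx hst))
    · have := hsub ⟨hts, not_le.1 hsu⟩
      exact hk (hs.trans_eq this)
  exact_mod_cast this

theorem hittingTime_mono (x : ℝ≥0 → ℕ) : Monotone (hittingTime x) := fun _ _ h =>
  le_iInf₂ fun t ht => iInf₂_le t (h.trans ht)

theorem hittingTime_zero (x : ℝ≥0 → ℕ) : hittingTime x 0 = 0 :=
  le_antisymm (iInf₂_le (0 : ℝ≥0) (Nat.zero_le _)) bot_le

theorem counts_eq_zero_of_le {N : ℕ → ℕ} (hmono : Monotone N) (act : ℕ → Bool)
    {j : ℕ → ℕ} (hj : ∀ n, j n < N n) {n v : ℕ} (h : N n ≤ v) : counts act j n v = 0 := by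
  induction n with
  | zero => rfl
  | succ n ih =>
    have hv := (hmono (Nat.le_succ n)).trans h
    have : v ≠ j n := by have := hj n; omega
    rw [counts]
    split_ifs
    · simp [ih hv, this]
    · exact ih hv

theorem raceWinner_lt {N : ℕ → ℕ} (hN : ∀ n, 0 < N n) (act : ℕ → Bool) (R : ℕ → ℕ → ℝ≥0∞) (n : ℕ) :
    raceWinner N act R n < N n := by
  unfold raceWinner
  split_ifs
  exacts [argminBelow_lt (hN n) _, hN n]

theorem urnWinner_lt (ρ : ℕ → ℝ≥0) {N : ℕ → ℕ} (hN : ∀ n, 0 < N n) (act : ℕ → Bool)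
    (τ : ℕ → ℕ → ℝ) (n : ℕ) : urnWinner ρ N act τ n < N n := by
  unfold urnWinner
  split_ifs
  exacts [argminBelow_lt (hN n) _, hN n]

/-- `Γ n` is the time of step `n`, if step `n + 1` happens at the first jump of one of the processes
`v < N n`, started at the times `Γ (S v)`. -/
structure IsJumpTimes (N : ℕ → ℕ) (act : ℕ → Bool) (S : ℕ → ℕ) (x : ℕ → ℝ≥0 → ℕ) (Γ : ℕ → ℝ≥0) :
    Prop where
  zero : Γ 0 = 0
  succ : ∀ n, Γ (n + 1) = if act n then nextJump (N n) (fun v => Γ (S v)) x (Γ n) else Γ n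

/-- The state of the processes at the time of step `n`. -/
structure PathInvariant (N : ℕ → ℕ) (act : ℕ → Bool) (S : ℕ → ℕ) (x : ℕ → ℝ≥0 → ℕ) (Γ : ℕ → ℝ≥0)
    (R : ℕ → ℕ → ℝ≥0∞) (n : ℕ) : Prop where
  start_le : ∀ v < N n, Γ (S v) ≤ Γ n
  wait : ∀ v < N n, ∀ i, raceState N act R n v i + Γ n =
    Γ (S v) + hittingTime (x v) (counts act (raceWinner N act R) n v + i + 1)
  wait_new : ∀ v, N n ≤ v → ∀ i, raceState N act R n v i = hittingTime (x v) (i + 1)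
  hit_le : ∀ v < N n, Γ (S v) + hittingTime (x v) (counts act (raceWinner N act R) n v) ≤ Γ n

/-- By `hit_le` the level `counts` has been reached, and the strictly positive residual waiting time
shows that the next level has not. -/
theorem PathInvariant.apply_eq {N : ℕ → ℕ} {act : ℕ → Bool} {S : ℕ → ℕ} {x : ℕ → ℝ≥0 → ℕ}
    {Γ : ℕ → ℝ≥0} {R : ℕ → ℕ → ℝ≥0∞} {n : ℕ} (h : PathInvariant N act S x Γ R n)
    (hx : ∀ v, Monotone (x v)) (hr : ∀ v t, ContinuousWithinAt (x v) (Set.Ici t) t)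
    (hpos : ∀ v, 0 < raceState N act R n v 0) {v : ℕ} (hv : v < N n) :
    x v (Γ n - Γ (S v)) = counts act (raceWinner N act R) n v := by
  set k := counts act (raceWinner N act R) n v
  have hle : k ≤ x v (Γ n - Γ (S v)) := by
    rw [le_iff_hittingTime_le (hx v) (hr v), ENNReal.coe_sub]
    exact ENNReal.le_sub_of_add_le_left ENNReal.coe_ne_top (h.hit_le v hv)
  have hlt : ¬ k + 1 ≤ x v (Γ n - Γ (S v)) := by
    rw [le_iff_hittingTime_le (hx v) (hr v), ENNReal.coe_sub, not_le]
    refine lt_of_not_ge fun hle => ?_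
    have h1 := h.wait v hv 0
    have h2 : (Γ (S v) : ℝ≥0∞) + hittingTime (x v) (k + 1) ≤ Γ n :=
      (add_le_add_right hle _).trans_eq
        (add_tsub_cancel_of_le (ENNReal.coe_le_coe.2 (h.start_le v hv)))
    rw [← (show _ = (Γ (S v) : ℝ≥0∞) + hittingTime (x v) (k + 1) from h1)] at h2
    rw [add_comm] at h2
    exact absurd h2 (not_le.2 (ENNReal.lt_add_right ENNReal.coe_ne_top (hpos v).ne'))
  omega

theorem PathInvariant.zero {N : ℕ → ℕ} {act : ℕ → Bool} {S : ℕ → ℕ} {x : ℕ → ℝ≥0 → ℕ}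
    {Γ : ℕ → ℝ≥0} (hS : ∀ n v, v < N n → S v ≤ n ∧ v < N (S v)) (hΓ : IsJumpTimes N act S x Γ) :
    PathInvariant N act S x Γ (fun v i => hittingTime (x v) (i + 1)) 0 := by
  have h0 : ∀ v < N 0, Γ (S v) = 0 := fun v hv => by
    rw [Nat.le_zero.1 (hS 0 v hv).1, hΓ.zero]
  refine ⟨fun v hv => by simp [h0 v hv], fun v hv i => ?_, fun v _ i => rfl, fun v hv => ?_⟩
  · simp [h0 v hv, hΓ.zero, raceState, counts]
  · simp [h0 v hv, counts, hittingTime_zero]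

/-- A path has left its current value by time `t` exactly when its residual waiting time has
elapsed. The times that compete in `nextJump` thus form the half-line starting at `Γ n + m`, where
`m` is the least residual waiting time. -/
theorem PathInvariant.nextJump_eq {N : ℕ → ℕ} {act : ℕ → Bool} {S : ℕ → ℕ} {x : ℕ → ℝ≥0 → ℕ}
    {Γ : ℕ → ℝ≥0} {R : ℕ → ℕ → ℝ≥0∞} {n : ℕ} (h : PathInvariant N act S x Γ R n)
    (hx : ∀ v, Monotone (x v)) (hr : ∀ v t, ContinuousWithinAt (x v) (Set.Ici t) t)
    (hN : 0 < N n) (hpos : ∀ v, 0 < raceState N act R n v 0) {m : ℝ≥0}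
    (hm : raceState N act R n (firstToJump (N n) (raceState N act R n)) 0 = m) :
    nextJump (N n) (fun v => Γ (S v)) x (Γ n) = Γ n + m := by
  have hm0 : 0 < m := by
    have := hpos (firstToJump (N n) (raceState N act R n))
    rw [hm] at this
    exact_mod_cast this
  have key : ∀ t, Γ n < t → ∀ v < N n,
      (x v (t - Γ (S v)) ≠ x v (Γ n - Γ (S v)) ↔ raceState N act R n v 0 + Γ n ≤ t) := by
    intro t ht v hv
    have hle : x v (Γ n - Γ (S v)) ≤ x v (t - Γ (S v)) := hx v (tsub_le_tsub_right ht.le _)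
    have hst : (Γ (S v) : ℝ≥0∞) ≤ t := ENNReal.coe_le_coe.2 ((h.start_le v hv).trans ht.le)
    rw [← hle.lt_iff_ne', ← Nat.succ_le_iff, h.apply_eq hx hr hpos hv,
      le_iff_hittingTime_le (hx v) (hr v), h.wait v hv 0, ENNReal.coe_sub]
    constructor
    · intro h'
      exact (add_le_add_right h' _).trans_eq (add_tsub_cancel_of_le hst)
    · exact fun h' => ENNReal.le_sub_of_add_le_left ENNReal.coe_ne_top h'
  have e : {t | Γ n < t ∧ ∃ v < N n, x v (t - Γ (S v)) ≠ x v (Γ n - Γ (S v))} =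
      Set.Ici (Γ n + m) := by
    ext t
    simp only [Set.mem_ofPred_eq, Set.mem_Ici]
    have hc : Γ n + m ≤ t ↔ (m : ℝ≥0∞) + Γ n ≤ t := by
      rw [add_comm]
      exact_mod_cast Iff.rfl
    rw [hc]
    constructor
    · rintro ⟨ht, v, hv, hne⟩
      refine le_trans (add_le_add_left ?_ _) ((key t ht v hv).1 hne)
      rw [← hm]
      exact apply_argminBelow_le (fun v => raceState N act R n v 0) hv
    · intro ht
      have ht' : Γ n < t := lt_of_lt_of_le (lt_add_of_pos_right _ hm0) (hc.2 ht)
      exact ⟨ht', _, argminBelow_lt hN _, (key t ht' _ (argminBelow_lt hN _)).2 (by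
        rw [← hm] at ht
        exact ht)⟩
  rw [nextJump, e, csInf_Ici]

theorem PathInvariant.succ {N : ℕ → ℕ} {act : ℕ → Bool} {S : ℕ → ℕ} {x : ℕ → ℝ≥0 → ℕ}
    {Γ : ℕ → ℝ≥0} {R : ℕ → ℕ → ℝ≥0∞} {n : ℕ} (h : PathInvariant N act S x Γ R n)
    (hN : ∀ n, 0 < N n) (hmono : Monotone N) (hS : ∀ n v, v < N n → S v ≤ n ∧ v < N (S v))
    (hΓ : IsJumpTimes N act S x Γ)
    (hx : ∀ v, Monotone (x v)) (hr : ∀ v t, ContinuousWithinAt (x v) (Set.Ici t) t)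
    (hpos : ∀ v, 0 < raceState N act R n v 0) (hfin : raceState N act R n 0 0 ≠ ∞) :
    PathInvariant N act S x Γ R (n + 1) := by
  -- A node present only from step `n + 1` on was created in that step, so its process has age zero
  -- and its row is still untouched.
  have hnew : ∀ v < N (n + 1), ¬ v < N n → S v = n + 1 := fun v hv hv' => by
    have h1 := hS (n + 1) v hv
    by_contra hne
    exact hv' (h1.2.trans_le (hmono (show S v ≤ n by omega)))
  have hc0 : ∀ v, ¬ v < N n → counts act (raceWinner N act R) (n + 1) v = 0 := fun v hv => by
    have h0 := counts_eq_zero_of_le hmono act (raceWinner_lt hN act R) (not_lt.1 hv)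
    have : v ≠ raceWinner N act R n := by have := raceWinner_lt hN act R n; omega
    rw [counts]
    split_ifs
    · simp [h0, this]
    · exact h0
  have hstate : ∀ v, ¬ v < N n → ∀ i,
      raceState N act R (n + 1) v i = hittingTime (x v) (i + 1) := fun v hv i => by
    rw [raceState, ← h.wait_new v (not_lt.1 hv) i]
    split_ifs
    · simp [advance, hv]
    · rfl
  have hstep : Γ n ≤ Γ (n + 1) ∧ ∀ v < N n,
      (∀ i, raceState N act R (n + 1) v i + Γ (n + 1) =
        Γ (S v) + hittingTime (x v) (counts act (raceWinner N act R) (n + 1) v + i + 1)) ∧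
      Γ (S v) + hittingTime (x v) (counts act (raceWinner N act R) (n + 1) v) ≤ Γ (n + 1) := by
    by_cases hact : act n = true
    swap
    · simp only [hΓ.succ n, raceState, counts, hact, if_false, Bool.false_eq_true]
      exact ⟨le_rfl, fun v hv => ⟨h.wait v hv, h.hit_le v hv⟩⟩
    set s := raceState N act R n with hs
    set J := firstToJump (N n) s with hJ
    have hJN : J < N n := argminBelow_lt (hN n) _
    have hwin : raceWinner N act R n = J := by simp [raceWinner, hact, hJ, hs]
    have hmin : ∀ v < N n, s J 0 ≤ s v 0 := fun v hv =>
      apply_argminBelow_le (fun v => s v 0) hv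
    -- The minimum is finite because the clock of node `0`, which takes part in every race, is
    -- finite.
    obtain ⟨m, hm⟩ : ∃ m : ℝ≥0, (m : ℝ≥0∞) = s J 0 :=
      ⟨_, ENNReal.coe_toNNReal (ne_top_of_le_ne_top hfin (hmin 0 (hN n)))⟩
    have hΓ' : Γ (n + 1) = Γ n + m := by
      rw [hΓ.succ n, if_pos hact]
      exact h.nextJump_eq hx hr (hN n) hpos hm.symm
    have hcount : ∀ v, counts act (raceWinner N act R) (n + 1) v =
        counts act (raceWinner N act R) n v + if v = J then 1 else 0 := fun v => by
      rw [counts, if_pos hact, hwin, Pi.add_apply, Pi.single_apply]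
    -- No recorded waiting time is below `m`, so the truncated subtraction in `advance` loses
    -- nothing.
    have hle : ∀ v < N n, ∀ i, (m : ℝ≥0∞) ≤ s v i := fun v hv i => by
      have h1 : s v 0 + Γ n ≤ s v i + Γ n := by
        rw [hs, h.wait v hv 0, h.wait v hv i]
        exact add_le_add_right (hittingTime_mono _ (by omega)) _
      rw [hm]
      exact (hmin v hv).trans ((ENNReal.add_le_add_iff_right ENNReal.coe_ne_top).1 h1)
    refine ⟨by rw [hΓ']; exact le_self_add, fun v hv => ⟨fun i => ?_, ?_⟩⟩
    · have h1 : raceState N act R (n + 1) v i = s v (if v = J then i + 1 else i) - m := by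
        rw [raceState, if_pos hact, advance, if_pos hv, hm]
      rw [h1, hΓ', ENNReal.coe_add, add_comm (Γ n : ℝ≥0∞), ← add_assoc,
        tsub_add_cancel_of_le (hle v hv _), hs, h.wait v hv, hcount]
      congr 2
      split_ifs <;> omega
    · rw [hcount]
      split_ifs with hvJ
      · have h1 := h.wait v hv 0
        rw [hΓ', add_comm (Γ n), ENNReal.coe_add, hm, ← hvJ]
        exact h1.ge
      · refine (h.hit_le v hv).trans ?_
        rw [hΓ']
        exact_mod_cast le_self_add
  refine ⟨fun v hv => ?_, fun v hv i => ?_, fun v hv i => ?_, fun v hv => ?_⟩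
  · by_cases hv' : v < N n
    · exact (h.start_le v hv').trans hstep.1
    · rw [hnew v hv hv']
  · by_cases hv' : v < N n
    · exact (hstep.2 v hv').1 i
    · rw [hstate v hv', hnew v hv hv', hc0 v hv', zero_add, add_comm]
  · exact hstate v (not_lt.2 ((hmono (Nat.le_succ n)).trans hv)) i
  · by_cases hv' : v < N n
    · exact (hstep.2 v hv').2
    · rw [hnew v hv hv', hc0 v hv', hittingTime_zero, add_zero]

/-- At the embedded jump times the paths count the races won. -/
theorem apply_jumpTimes_eq_counts {N : ℕ → ℕ} {act : ℕ → Bool} {S : ℕ → ℕ} {x : ℕ → ℝ≥0 → ℕ}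
    {Γ : ℕ → ℝ≥0} {R : ℕ → ℕ → ℝ≥0∞} (hR : R = fun v i => hittingTime (x v) (i + 1))
    (hN : ∀ n, 0 < N n) (hmono : Monotone N) (hS : ∀ n v, v < N n → S v ≤ n ∧ v < N (S v))
    (hΓ : IsJumpTimes N act S x Γ)
    (hx : ∀ v, Monotone (x v)) (hr : ∀ v t, ContinuousWithinAt (x v) (Set.Ici t) t)
    (hpos : ∀ n v, 0 < raceState N act R n v 0) (hfin : ∀ n, raceState N act R n 0 0 ≠ ∞)
    {n v : ℕ} (hv : v < N n) :
    x v (Γ n - Γ (S v)) = counts act (raceWinner N act R) n v := by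
  have h : ∀ n, PathInvariant N act S x Γ R n := fun n => by
    induction n with
    | zero => exact hR ▸ PathInvariant.zero hS hΓ
    | succ n ih => exact ih.succ hN hmono hS hΓ hx hr (hpos n) (hfin n)
  exact (h n).apply_eq hx hr (hpos n) hv

/-! ### The number of nodes -/

theorem nodeCount_pos (b : ℕ → Bool) (n : ℕ) : 0 < nodeCount b n := by
  unfold nodeCount
  omega

theorem nodeCount_succ (b : ℕ → Bool) (n : ℕ) :
    nodeCount b (n + 1) = nodeCount b n + (b n).toNat := by
  simp only [nodeCount, Finset.sum_range_succ]
  omega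

theorem nodeCount_mono (b : ℕ → Bool) : Monotone (nodeCount b) :=
  monotone_nat_of_le_succ fun n => by
    rw [nodeCount_succ]
    omega

theorem nodeCount_congr {b b' : ℕ → Bool} {n : ℕ} (h : ∀ m < n, b m = b' m) :
    nodeCount b n = nodeCount b' n := by
  unfold nodeCount
  rw [Finset.sum_congr rfl fun m hm => by rw [h m (Finset.mem_range.1 hm)]]

theorem creationTime_spec (b : ℕ → Bool) (n v : ℕ) (h : v < nodeCount b n) :
    creationTime b v ≤ n ∧ v < nodeCount b (creationTime b v) := by
  refine ⟨creationTime_le b n v h, ?_⟩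
  obtain ⟨m, -, hm⟩ := exists_nodeCount_eq b n v h
  have : nodeCount b (creationTime b v) = v + 1 :=
    Nat.sInf_mem (s := {n | nodeCount b n = v + 1}) ⟨m, hm⟩
  omega

/-! ### Degrees as functions of the chosen nodes -/

/-- The degrees of the nodes present after `n` steps, if node `v` starts with degree `ι v`. -/
def tally (ι : ℕ → ℕ) (N : ℕ → ℕ) (act : ℕ → Bool) (j : ℕ → ℕ) (n v : ℕ) : ℕ :=
  if v < N n then ι v + counts act j n v else 0

theorem degrees_two_mul_add_one (δin δout : ℝ≥0) (b : ℕ → Bool) (τ τ' : ℕ → ℕ → ℝ) (n : ℕ) :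
    degrees δin δout b τ τ' (2 * n + 1) = degrees δin δout b τ τ' (2 * n) +
      Pi.single (argminBelow (nodeCount b n) fun v =>
        clock δin (τ n v) (degrees δin δout b τ τ' (2 * n) v).1) (1, 0) := by
  have h1 : 2 * n / 2 = n := by omega
  have h2 : 2 * n % 2 = 0 := by omega
  rw [degrees]
  simp only [h1, h2, if_true]

theorem degrees_two_mul_succ (δin δout : ℝ≥0) (b : ℕ → Bool) (τ τ' : ℕ → ℕ → ℝ) (n : ℕ) :
    degrees δin δout b τ τ' (2 * (n + 1)) = degrees δin δout b τ τ' (2 * n + 1) +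
      if b n then Pi.single (nodeCount b n) (0, 1) else
        Pi.single (argminBelow (nodeCount b n) fun v =>
          clock δout (τ' n v) (degrees δin δout b τ τ' (2 * n + 1) v).2) (0, 1) := by
  have h1 : (2 * n + 1) / 2 = n := by omega
  have h2 : (2 * n + 1) % 2 = 1 := by omega
  rw [show 2 * (n + 1) = 2 * n + 1 + 1 by ring, degrees]
  simp only [h1, h2, one_ne_zero, if_false]
  split_ifs <;> rfl

theorem inDegree_succ (δin δout : ℝ≥0) (b : ℕ → Bool) (τ τ' : ℕ → ℕ → ℝ) (n : ℕ) :
    inDegree δin δout b τ τ' (n + 1) = inDegree δin δout b τ τ' n +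
      Pi.single (argminBelow (nodeCount b n) fun v =>
        clock δin (τ n v) (inDegree δin δout b τ τ' n v)) 1 := by
  ext v
  simp only [inDegree, degrees_two_mul_succ, degrees_two_mul_add_one, Pi.add_apply, Prod.fst_add,
    Pi.single_apply]
  split_ifs <;> simp_all [Pi.single_apply] <;> split_ifs <;> rfl

theorem outDegree_succ (δin δout : ℝ≥0) (b : ℕ → Bool) (τ τ' : ℕ → ℕ → ℝ) (n : ℕ) :
    outDegree δin δout b τ τ' (n + 1) = outDegree δin δout b τ τ' n +
      if b n then Pi.single (nodeCount b n) 1 else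
        Pi.single (argminBelow (nodeCount b n) fun v =>
          clock δout (τ' n v) (outDegree δin δout b τ τ' n v)) 1 := by
  have h : ∀ v, (degrees δin δout b τ τ' (2 * n + 1) v).2 =
      (degrees δin δout b τ τ' (2 * n) v).2 := fun v => by
    rw [degrees_two_mul_add_one, Pi.add_apply, Prod.snd_add, Pi.single_apply]
    split_ifs <;> simp
  ext v
  simp only [outDegree, degrees_two_mul_succ, Pi.add_apply, Prod.snd_add, h]
  split_ifs <;> simp only [Pi.single_apply] <;> split_ifs <;> rfl

/-- The restriction to existing nodes in `tally` is harmless: an absent node is not node `0`, and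
has never been chosen, so both sides vanish. -/
theorem inDegree_eq_tally (δin δout : ℝ≥0) (b : ℕ → Bool) (τ τ' : ℕ → ℕ → ℝ) :
    inDegree δin δout b τ τ' = tally (fun v => if v = 0 then 1 else 0) (nodeCount b) (fun _ => true)
      (urnWinner (fun v => (if v = 0 then 1 else 0) + δin) (nodeCount b) (fun _ => true) τ) := by
  set ρ : ℕ → ℝ≥0 := fun v => (if v = 0 then 1 else 0) + δin
  have h : ∀ n v, inDegree δin δout b τ τ' n v =
      (if v = 0 then 1 else 0) + urn ρ (nodeCount b) (fun _ => true) τ n v := by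
    intro n
    induction n with
    | zero =>
      intro v
      simp only [inDegree, degrees, Pi.single_apply, urn]
      split_ifs <;> rfl
    | succ n ih =>
      intro v
      have hclock : ∀ v, clock δin (τ n v) (inDegree δin δout b τ τ' n v) =
          ENNReal.ofReal (τ n v) / (urn ρ (nodeCount b) (fun _ => true) τ n v + ρ v : ℝ≥0) := by
        intro v
        rw [clock, ih]
        congr 1
        simp only [ρ]
        split_ifs <;> push_cast <;> ring
      rw [inDegree_succ, urn, if_pos rfl, Pi.add_apply, Pi.add_apply, ih, add_assoc]
      simp only [hclock]
  ext n v
  rw [h, urn_eq_counts, tally]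
  by_cases hv : v < nodeCount b n
  · rw [if_pos hv]
  · have hv0 : v ≠ 0 := fun h0 => hv (h0 ▸ nodeCount_pos b n)
    rw [if_neg hv, if_neg hv0, counts_eq_zero_of_le (nodeCount_mono b) _
      (urnWinner_lt ρ (nodeCount_pos b) _ τ) (not_lt.1 hv)]

/-- A new node enters with out-degree one, which is the constant part of `ρ`. The rates agree only
for existing nodes, but only these take part in the minimum. -/
theorem outDegree_eq_tally (δin δout : ℝ≥0) (b : ℕ → Bool) (τ τ' : ℕ → ℕ → ℝ) :
    outDegree δin δout b τ τ' = tally (fun _ => 1) (nodeCount b) (fun n => !b n)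
      (urnWinner (fun _ => 1 + δout) (nodeCount b) (fun n => !b n) τ') := by
  set ρ : ℕ → ℝ≥0 := fun _ => 1 + δout
  have h : ∀ n v, outDegree δin δout b τ τ' n v =
      if v < nodeCount b n then 1 + urn ρ (nodeCount b) (fun n => !b n) τ' n v else 0 := by
    intro n
    induction n with
    | zero =>
      intro v
      simp only [outDegree, degrees, Pi.single_apply, urn, nodeCount]
      rcases eq_or_ne v 0 with rfl | hv
      · simp
      · have : ¬ v < 1 := by omega
        simp [hv]
    | succ n ih =>
      intro v
      have hclock : ∀ v < nodeCount b n, clock δout (τ' n v) (outDegree δin δout b τ τ' n v) =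
          ENNReal.ofReal (τ' n v) /
            (urn ρ (nodeCount b) (fun n => !b n) τ' n v + ρ v : ℝ≥0) := by
        intro v hv
        rw [clock, ih, if_pos hv]
        congr 1
        simp only [ρ]
        push_cast
        ring
      rw [outDegree_succ, urn, Pi.add_apply, ih, nodeCount_succ, argminBelow_congr hclock]
      have hz : nodeCount b n ≤ v → urn ρ (nodeCount b) (fun n => !b n) τ' n v = 0 := fun hv => by
        rw [urn_eq_counts, counts_eq_zero_of_le (nodeCount_mono b) _
          (urnWinner_lt ρ (nodeCount_pos b) _ τ') hv]
      cases hb : b n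
      · have hJ := argminBelow_lt (nodeCount_pos b n) fun v => ENNReal.ofReal (τ' n v) /
            (urn ρ (nodeCount b) (fun n => !b n) τ' n v + ρ v : ℝ≥0)
        simp only [Bool.false_eq_true, if_false, Bool.not_false, if_true, Bool.toNat_false,
          add_zero, Pi.add_apply, Pi.single_apply]
        split_ifs <;> omega
      · simp only [if_true, Bool.not_true, Bool.false_eq_true, if_false, Bool.toNat_true,
          Pi.single_apply]
        split_ifs <;> omega
  ext n v
  rw [h, urn_eq_counts, tally]

theorem isJumpTimes_inJumpTime (b : ℕ → Bool) (x : ℕ → ℝ≥0 → ℕ) :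
    IsJumpTimes (nodeCount b) (fun _ => true) (creationTime b) x (inJumpTime b x) where
  zero := by rw [inJumpTime]
  succ n := by rw [inJumpTime_succ, if_pos rfl]

theorem isJumpTimes_outJumpTime (b : ℕ → Bool) (x : ℕ → ℝ≥0 → ℕ) :
    IsJumpTimes (nodeCount b) (fun n => !b n) (creationTime b) x (outJumpTime b x) where
  zero := by rw [outJumpTime]
  succ n := by
    rw [outJumpTime_succ]
    cases b n <;> rfl

/-! ### Dependence on the sequence of new nodes -/

/-- Dependence on finitely many bits leaves finitely many cases for `b`, so measurability in the
second variable implies joint measurability. -/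
theorem measurable_of_prefix {E F : Type*} [MeasurableSpace E] [MeasurableSpace F]
    {f : (ℕ → Bool) → E → F} (n : ℕ) (hf : ∀ b, Measurable (f b))
    (hdep : ∀ b b', (∀ m < n, b m = b' m) → f b = f b') :
    Measurable fun p : (ℕ → Bool) × E => f p.1 p.2 := by
  let ext : (Fin n → Bool) → ℕ → Bool := fun c m => if h : m < n then c ⟨m, h⟩ else false
  have hg : Measurable fun p : E × (Fin n → Bool) => f (ext p.2) p.1 :=
    measurable_from_prod_countable_left fun c => hf (ext c)
  have hr : Measurable fun (b : ℕ → Bool) (i : Fin n) => b i :=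
    measurable_pi_iff.2 fun i => measurable_pi_apply (i : ℕ)
  have e : (fun p : (ℕ → Bool) × E => f p.1 p.2) =
      (fun p : E × (Fin n → Bool) => f (ext p.2) p.1) ∘
        fun p : (ℕ → Bool) × E => (p.2, fun i : Fin n => p.1 i) := by
    ext1 p
    simp only [Function.comp]
    rw [hdep p.1 (ext fun i => p.1 i) fun m hm => by simp [ext, hm]]
  rw [e]
  exact hg.comp (measurable_snd.prodMk (hr.comp measurable_fst))

theorem measurable_counts (act : ℕ → Bool) (n : ℕ) : Measurable fun j => counts act j n := by
  induction n with
  | zero => exact measurable_const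
  | succ n ih =>
    simp only [counts]
    cases act n
    · exact ih
    · have hs : Measurable fun j : ℕ => (Pi.single j 1 : ℕ → ℕ) := measurable_from_top
      exact ih.add (hs.comp (measurable_pi_apply n))

theorem measurable_tally (ι N : ℕ → ℕ) (act : ℕ → Bool) : Measurable (tally ι N act) := by
  refine measurable_pi_iff.2 fun n => measurable_pi_iff.2 fun v => ?_
  unfold tally
  split_ifs
  · exact measurable_const.add ((measurable_pi_apply v).comp (measurable_counts act n))
  · exact measurable_const

/-- The degrees of the nodes, when a node is chosen in the steps `n` with `f (b n)`. -/
noncomputable def urnTally (ρ : ℕ → ℝ≥0) (ι : ℕ → ℕ) (f : Bool → Bool) (b : ℕ → Bool)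
    (τ : ℕ → ℕ → ℝ) : ℕ → ℕ → ℕ :=
  tally ι (nodeCount b) (fun n => f (b n)) (urnWinner ρ (nodeCount b) (fun n => f (b n)) τ)

noncomputable def raceTally (ι : ℕ → ℕ) (f : Bool → Bool) (b : ℕ → Bool)
    (R : ℕ → ℕ → ℝ≥0∞) : ℕ → ℕ → ℕ :=
  tally ι (nodeCount b) (fun n => f (b n)) (raceWinner (nodeCount b) (fun n => f (b n)) R)

theorem tally_congr (ι : ℕ → ℕ) {N N' : ℕ → ℕ} {act act' : ℕ → Bool} {j j' : ℕ → ℕ} {n : ℕ}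
    (hN : N n = N' n) (h : ∀ m < n, act m = act' m) (hj : ∀ m < n, j m = j' m) :
    tally ι N act j n = tally ι N' act' j' n := by
  ext v
  rw [tally, tally, hN, counts_congr h hj]

theorem measurable_urnTally_apply (ρ : ℕ → ℝ≥0) (ι : ℕ → ℕ) (f : Bool → Bool) (b : ℕ → Bool) :
    Measurable (urnTally ρ ι f b) :=
  (measurable_tally _ _ _).comp (measurable_urnWinner _ _ _)

theorem measurable_raceTally_apply (ι : ℕ → ℕ) (f : Bool → Bool) (b : ℕ → Bool) :
    Measurable (raceTally ι f b) :=
  (measurable_tally _ _ _).comp (measurable_raceWinner _ _)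

theorem measurable_urnTally (ρ : ℕ → ℝ≥0) (ι : ℕ → ℕ) (f : Bool → Bool) :
    Measurable fun p : (ℕ → Bool) × (ℕ → ℕ → ℝ) => urnTally ρ ι f p.1 p.2 := by
  refine measurable_pi_iff.2 fun n => ?_
  refine measurable_of_prefix (f := fun b τ => urnTally ρ ι f b τ n) n (fun b => ?_)
    fun b b' h => ?_
  · exact (measurable_pi_apply n).comp (measurable_urnTally_apply ρ ι f b)
  · ext1 τ
    have hN : ∀ m ≤ n, nodeCount b m = nodeCount b' m := fun m hm =>
      nodeCount_congr fun l hl => h l (by omega)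
    refine tally_congr ι (hN n le_rfl) (fun m hm => by rw [h m hm]) fun m hm => ?_
    rw [urnWinner, urnWinner, urn_congr ρ τ (fun l hl => hN l (by omega))
      (fun l hl => by rw [h l (by omega)] : ∀ l < m, f (b l) = f (b' l)), hN m hm.le, h m hm]

theorem measurable_raceTally (ι : ℕ → ℕ) (f : Bool → Bool) :
    Measurable fun p : (ℕ → Bool) × (ℕ → ℕ → ℝ≥0∞) => raceTally ι f p.1 p.2 := by
  refine measurable_pi_iff.2 fun n => ?_
  refine measurable_of_prefix (f := fun b R => raceTally ι f b R n) n (fun b => ?_)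
    fun b b' h => ?_
  · exact (measurable_pi_apply n).comp (measurable_raceTally_apply ι f b)
  · ext1 R
    have hN : ∀ m ≤ n, nodeCount b m = nodeCount b' m := fun m hm =>
      nodeCount_congr fun l hl => h l (by omega)
    refine tally_congr ι (hN n le_rfl) (fun m hm => by rw [h m hm]) fun m hm => ?_
    rw [raceWinner, raceWinner, raceState_congr R (fun l hl => hN l (by omega))
      (fun l hl => by rw [h l (by omega)] : ∀ l < m, f (b l) = f (b' l)), hN m hm.le, h m hm]

/-- The laws agree for every fixed sequence `b`. -/
theorem map_urnTally_eq {ρ : ℕ → ℝ≥0} (hρ : ρ 0 ≠ 0) (ι : ℕ → ℕ) (f : Bool → Bool)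
    (b : ℕ → Bool) :
    (Measure.infinitePi fun _ : ℕ => Measure.infinitePi fun _ : ℕ => expMeasure 1).map
      (urnTally ρ ι f b) = (raceLaw ρ 0).map (raceTally ι f b) := by
  have h := congrArg (Measure.map (tally ι (nodeCount b) fun n => f (b n)))
    (map_urnWinner_eq hρ (nodeCount_pos b) fun n => f (b n))
  rw [Measure.map_map (measurable_tally _ _ _) (measurable_urnWinner _ _ _),
    Measure.map_map (measurable_tally _ _ _) (measurable_raceWinner _ _)] at h
  exact h

/-- Almost surely, for all sequences `b`, no two processes ever jump at the same time, and there is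
always a next jump. -/
theorem ae_raceState_pos {ρ : ℕ → ℝ≥0} (hρ : ρ 0 ≠ 0) (f : Bool → Bool) :
    ∀ᵐ R ∂raceLaw ρ 0, ∀ b : ℕ → Bool, ∀ n,
      (∀ v, 0 < raceState (nodeCount b) (fun n => f (b n)) R n v 0) ∧
        raceState (nodeCount b) (fun n => f (b n)) R n 0 0 ≠ ∞ := by
  -- There are uncountably many `b`, but the state after `n` steps depends only on the first `n`
  -- entries; finite lists exhaust these, and there are countably many.
  have h : ∀ᵐ R ∂raceLaw ρ 0, ∀ (l : List Bool) (n : ℕ),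
      (∀ v, 0 < raceState (nodeCount fun m => l.getD m false)
        (fun n => f (l.getD n false)) R n v 0) ∧
        raceState (nodeCount fun m => l.getD m false) (fun n => f (l.getD n false)) R n 0 0 ≠ ∞ :=
    ae_all_iff.2 fun l => ae_all_iff.2 fun n =>
      ae_raceState_mem hρ (nodeCount_pos fun m => l.getD m false) (fun n => f (l.getD n false))
        (p := fun R => (∀ v, 0 < R v 0) ∧ R 0 0 ≠ ∞)
        (fun k => (ae_raceLaw_pos ρ k).and (ae_raceLaw_ne_top hρ k)) n
  filter_upwards [h] with R hR b n
  obtain ⟨l, hl⟩ := exists_list_getD_eq b false n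
  have e : raceState (nodeCount b) (fun n => f (b n)) R n =
      raceState (nodeCount fun m => l.getD m false) (fun n => f (l.getD n false)) R n :=
    raceState_congr R (fun m hm => nodeCount_congr fun i hi => (hl i (by omega)).symm)
      fun m hm => by rw [hl m hm]
  rw [e]
  exact hR l n

theorem inEmbedding_eq_raceTally (b : ℕ → Bool) {x : ℕ → ℝ≥0 → ℕ} {R : ℕ → ℕ → ℝ≥0∞}
    (hR : R = fun v i => hittingTime (x v) (i + 1))
    (hx : ∀ v, Monotone (x v)) (hr : ∀ v t, ContinuousWithinAt (x v) (Set.Ici t) t)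
    (h : ∀ n, (∀ v, 0 < raceState (nodeCount b) (fun _ => true) R n v 0) ∧
      raceState (nodeCount b) (fun _ => true) R n 0 0 ≠ ∞) :
    inEmbedding b x = raceTally (fun v => if v = 0 then 1 else 0) (fun _ => true) b R := by
  ext n v
  simp only [inEmbedding, raceTally, tally]
  split_ifs with hv
  all_goals first
    | rfl
    | rw [apply_jumpTimes_eq_counts hR (nodeCount_pos b) (nodeCount_mono b) (creationTime_spec b)
        (isJumpTimes_inJumpTime b x) hx hr (fun n => (h n).1) (fun n => (h n).2) hv]

theorem outEmbedding_eq_raceTally (b : ℕ → Bool) {x : ℕ → ℝ≥0 → ℕ} {R : ℕ → ℕ → ℝ≥0∞}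
    (hR : R = fun v i => hittingTime (x v) (i + 1))
    (hx : ∀ v, Monotone (x v)) (hr : ∀ v t, ContinuousWithinAt (x v) (Set.Ici t) t)
    (h : ∀ n, (∀ v, 0 < raceState (nodeCount b) (fun n => !b n) R n v 0) ∧
      raceState (nodeCount b) (fun n => !b n) R n 0 0 ≠ ∞) :
    outEmbedding b x = raceTally (fun _ => 1) (fun a => !a) b R := by
  ext n v
  simp only [outEmbedding, raceTally, tally]
  split_ifs with hv
  · rw [apply_jumpTimes_eq_counts hR (nodeCount_pos b) (nodeCount_mono b) (creationTime_spec b)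
      (isJumpTimes_outJumpTime b x) hx hr (fun n => (h n).1) (fun n => (h n).2) hv]
  · rfl

/-! ### Joint laws -/

theorem infinitePi_prod_map_sumElim {ι κ E : Type*} [MeasurableSpace E] {M : ι → Measure E}
    {M' : κ → Measure E} [∀ i, IsProbabilityMeasure (M i)] [∀ i, IsProbabilityMeasure (M' i)]
    [∀ i, IsProbabilityMeasure (Sum.elim M M' i)] :
    ((Measure.infinitePi M).prod (Measure.infinitePi M')).map (fun p => Sum.elim p.1 p.2) =
      Measure.infinitePi (Sum.elim M M') := by
  have hm : Measurable fun p : (ι → E) × (κ → E) => Sum.elim p.1 p.2 := by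
    refine measurable_pi_iff.2 fun i => ?_
    cases i with
    | inl i => exact (measurable_pi_apply i).comp measurable_fst
    | inr i => exact (measurable_pi_apply i).comp measurable_snd
  refine Measure.eq_infinitePi _ fun s t ht => ?_
  have hpi : MeasurableSet (Set.pi (s : Set (ι ⊕ κ)) t) :=
    MeasurableSet.pi s.countable_toSet fun i _ => ht i
  have e : (fun p : (ι → E) × (κ → E) => Sum.elim p.1 p.2) ⁻¹' Set.pi s t =
      Set.pi (s.toLeft : Set ι) (fun i => t (Sum.inl i)) ×ˢ
        Set.pi (s.toRight : Set κ) (fun i => t (Sum.inr i)) := by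
    ext p
    simp [Set.mem_pi]
  rw [Measure.map_apply hm hpi, e, Measure.prod_prod, Measure.infinitePi_pi _ fun i _ => ht _,
    Measure.infinitePi_pi _ fun i _ => ht _]
  conv_rhs => rw [← Finset.toLeft_disjSum_toRight (u := s), Finset.prod_disjSum]
  rfl

/-- The joint law of two families that are jointly independent. -/
theorem map_prodMk_of_iIndepFun_sumElim {Ω ι κ E : Type*} [MeasurableSpace Ω] {μ : Measure Ω}
    [Countable ι] [Countable κ] [MeasurableSpace E] {M : ι → Measure E} {M' : κ → Measure E}
    [∀ i, IsProbabilityMeasure (M i)] [∀ i, IsProbabilityMeasure (M' i)]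
    {Z : ι → Ω → E} {Z' : κ → Ω → E}
    (hZ : ∀ i, HasLaw (Z i) (M i) μ) (hZ' : ∀ i, HasLaw (Z' i) (M' i) μ)
    (h : iIndepFun (Sum.elim Z Z') μ) :
    μ.map (fun ω => (fun i => Z i ω, fun i => Z' i ω)) =
      (Measure.infinitePi M).prod (Measure.infinitePi M') := by
  have hp : ∀ i, IsProbabilityMeasure (Sum.elim M M' i) := by
    rintro (i | i)
    exacts [inferInstanceAs (IsProbabilityMeasure (M i)), inferInstanceAs (IsProbabilityMeasure (M' i))]
  have hlaw : ∀ i, HasLaw (Sum.elim Z Z' i) (Sum.elim M M' i) μ := by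
    rintro (i | i)
    exacts [hZ i, hZ' i]
  have hae : AEMeasurable (fun ω i => Sum.elim Z Z' i ω) μ :=
    aemeasurable_pi_iff.2 fun i => (hlaw i).aemeasurable
  have hj := (h.hasLaw_infinitePi hlaw hae).map_eq
  have hm : Measurable fun p : (ι → E) × (κ → E) => Sum.elim p.1 p.2 := by
    refine measurable_pi_iff.2 fun i => ?_
    cases i with
    | inl i => exact (measurable_pi_apply i).comp measurable_fst
    | inr i => exact (measurable_pi_apply i).comp measurable_snd
  have hs : Measurable fun g : ι ⊕ κ → E => (fun i => g (Sum.inl i), fun i => g (Sum.inr i)) :=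
    (measurable_pi_iff.2 fun i => measurable_pi_apply _).prodMk
      (measurable_pi_iff.2 fun i => measurable_pi_apply _)
  have := congrArg (Measure.map fun g : ι ⊕ κ → E => (fun i => g (Sum.inl i), fun i => g (Sum.inr i)))
    (hj.trans infinitePi_prod_map_sumElim.symm)
  rw [AEMeasurable.map_map_of_aemeasurable hs.aemeasurable hae, Measure.map_map hs hm] at this
  exact this.trans Measure.map_id

theorem map_prodMk_congr {β E₁ E₂ G : Type*} [MeasurableSpace β] [MeasurableSpace E₁]
    [MeasurableSpace E₂] [MeasurableSpace G] {ν : Measure β} {ν₁ : Measure E₁} {ν₂ : Measure E₂}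
    [SFinite ν] [SFinite ν₁] [SFinite ν₂] {F₁ : β → E₁ → G} {F₂ : β → E₂ → G}
    (h₁ : Measurable fun p : β × E₁ => F₁ p.1 p.2) (h₂ : Measurable fun p : β × E₂ => F₂ p.1 p.2)
    (h : ∀ b, ν₁.map (F₁ b) = ν₂.map (F₂ b)) :
    (ν.prod ν₁).map (fun p => (p.1, F₁ p.1 p.2)) = (ν.prod ν₂).map (fun p => (p.1, F₂ p.1 p.2)) := by
  have h₁' := measurable_fst.prodMk h₁
  have h₂' := measurable_fst.prodMk h₂
  ext C hC
  rw [Measure.map_apply h₁' hC, Measure.map_apply h₂' hC, Measure.prod_apply (h₁' hC),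
    Measure.prod_apply (h₂' hC)]
  refine lintegral_congr fun b => ?_
  have hCb : MeasurableSet (Prod.mk b ⁻¹' C) := measurable_prodMk_left hC
  have := congrArg (fun m => m (Prod.mk b ⁻¹' C)) (h b)
  have m₁ : Measurable (F₁ b) := h₁.comp measurable_prodMk_left
  have m₂ : Measurable (F₂ b) := h₂.comp measurable_prodMk_left
  rw [Measure.map_apply m₁ hCb, Measure.map_apply m₂ hCb] at this
  exact this

theorem measurable_prodMap_uncurry {β E E' G G' : Type*} [MeasurableSpace β] [MeasurableSpace E]
    [MeasurableSpace E'] [MeasurableSpace G] [MeasurableSpace G'] {F : β → E → G} {F' : β → E' → G'}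
    (h : Measurable fun p : β × E => F p.1 p.2) (h' : Measurable fun p : β × E' => F' p.1 p.2) :
    Measurable fun p : β × E × E' => Prod.map (F p.1) (F' p.1) p.2 :=
  (h.comp (measurable_fst.prodMk (measurable_fst.comp measurable_snd))).prodMk
    (h'.comp (measurable_fst.prodMk (measurable_snd.comp measurable_snd)))

theorem map_prodMk_comp_congr {Ω β G K : Type*} [MeasurableSpace Ω] [MeasurableSpace β]
    [MeasurableSpace G] [MeasurableSpace K] {μ : Measure Ω} {B : Ω → β} {U U' : Ω → G}
    (hB : AEMeasurable B μ) (hU : AEMeasurable U μ) (hU' : AEMeasurable U' μ) {g : G → K}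
    (hg : Measurable g) (h : μ.map (fun ω => (B ω, U ω)) = μ.map (fun ω => (B ω, U' ω))) :
    μ.map (fun ω => (B ω, g (U ω))) = μ.map (fun ω => (B ω, g (U' ω))) := by
  have hg' : Measurable fun p : β × G => (p.1, g p.2) :=
    measurable_fst.prodMk (hg.comp measurable_snd)
  have := congrArg (Measure.map fun p : β × G => (p.1, g p.2)) h
  rw [AEMeasurable.map_map_of_aemeasurable hg'.aemeasurable (hB.prodMk hU),
    AEMeasurable.map_map_of_aemeasurable hg'.aemeasurable (hB.prodMk hU')] at this
  exact this

theorem identDistrib_of_map_prodMk_eq {Ω β G : Type*} [MeasurableSpace Ω] [MeasurableSpace β]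
    [MeasurableSpace G] {μ : Measure Ω} {B : Ω → β} {U U' : Ω → G}
    (hB : AEMeasurable B μ) (hU : AEMeasurable U μ) (hU' : AEMeasurable U' μ)
    (h : μ.map (fun ω => (B ω, U ω)) = μ.map (fun ω => (B ω, U' ω))) :
    IdentDistrib U U' μ μ := by
  refine ⟨hU, hU', ?_⟩
  have := congrArg (Measure.map Prod.snd) h
  rw [AEMeasurable.map_map_of_aemeasurable measurable_snd.aemeasurable (hB.prodMk hU),
    AEMeasurable.map_map_of_aemeasurable measurable_snd.aemeasurable (hB.prodMk hU')] at this
  exact this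

/-- `condDistrib` is defined as the conditional kernel of the joint law, so equal joint laws give
the same kernel, not merely almost everywhere. -/
theorem condDistrib_congr_of_map_prodMk_eq {Ω β G : Type*} [MeasurableSpace Ω] [MeasurableSpace β]
    [MeasurableSpace G] [StandardBorelSpace G] [Nonempty G] {μ : Measure Ω} [IsFiniteMeasure μ]
    {B : Ω → β} {U U' : Ω → G}
    (h : μ.map (fun ω => (B ω, U ω)) = μ.map (fun ω => (B ω, U' ω))) :
    condDistrib U B μ = condDistrib U' B μ := by
  simp only [condDistrib_def]
  congr

/-! ### The hitting times of a birth-immigration process -/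

/-- The hitting times `hittingTime x (i + 1)` of a monotone path, read off at countably many
times. -/
noncomputable def hitRow (x : ℝ≥0 → ℕ) (i : ℕ) : ℝ≥0∞ :=
  ⨅ n : ℕ, if i + 1 ≤ x (TopologicalSpace.denseSeq ℝ≥0 n) then
    (TopologicalSpace.denseSeq ℝ≥0 n : ℝ≥0∞) else ∞

theorem measurable_hitRow : Measurable hitRow := by
  refine measurable_pi_iff.2 fun i => Measurable.iInf fun n => ?_
  have h : Measurable fun k : ℕ => if i + 1 ≤ k then
    (TopologicalSpace.denseSeq ℝ≥0 n : ℝ≥0∞) else ∞ := measurable_from_top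
  exact h.comp (measurable_pi_apply _)

/-- `hittingTime` involves uncountably many coordinates of the path. For a monotone path a dense set
of times suffices, and this gives a measurable functional to which the independence of the paths
transfers. -/
theorem hitRow_eq {x : ℝ≥0 → ℕ} (hx : Monotone x) (i : ℕ) :
    hitRow x i = hittingTime x (i + 1) := by
  refine le_antisymm (le_iInf₂ fun t ht => ?_) (le_iInf fun n => ?_)
  · refine ENNReal.le_of_forall_pos_le_add fun ε hε _ => ?_
    obtain ⟨_, ⟨n, rfl⟩, h1, h2⟩ := (TopologicalSpace.denseRange_denseSeq ℝ≥0).exists_between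
      (lt_add_of_pos_right t hε)
    refine (iInf_le _ n).trans ?_
    rw [if_pos (ht.trans (hx h1.le))]
    exact_mod_cast h2.le
  · split_ifs with h
    · exact iInf₂_le (TopologicalSpace.denseSeq ℝ≥0 n) h
    · exact le_top

theorem rowLaw_zero_eq (ρ : ℝ≥0) :
    rowLaw ρ 0 = ((Measure.infinitePi fun _ : ℕ => expMeasure 1).map
      (fun e (k : ℕ) => ∑ i ∈ Finset.range k, ENNReal.ofReal (e i) / ((i : ℝ≥0∞) + ρ))).map
        (fun g i => g (i + 1)) := by
  have hm : Measurable fun (e : ℕ → ℝ) (k : ℕ) =>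
      ∑ i ∈ Finset.range k, ENNReal.ofReal (e i) / ((i : ℝ≥0∞) + ρ) :=
    measurable_pi_iff.2 fun k => Finset.measurable_sum _ fun i _ =>
      (measurable_ofReal_div _).comp (measurable_pi_apply i)
  have hs : Measurable fun (g : ℕ → ℝ≥0∞) (i : ℕ) => g (i + 1) :=
    measurable_pi_iff.2 fun i => measurable_pi_apply _
  have h : (Measure.infinitePi fun i : ℕ => clockLaw ((0 + i : ℕ) + ρ)) =
      (Measure.infinitePi fun _ : ℕ => expMeasure 1).map
        fun e (i : ℕ) => ENNReal.ofReal (e i) / (((0 + i : ℕ) + ρ : ℝ≥0) : ℝ≥0∞) := by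
    rw [Measure.infinitePi_map_pi (fun _ : ℕ => expMeasure 1)
      (f := fun i x => ENNReal.ofReal x / (((0 + i : ℕ) + ρ : ℝ≥0) : ℝ≥0∞))
      fun i => measurable_ofReal_div _]
    rfl
  have hm' : Measurable fun (e : ℕ → ℝ) (i : ℕ) =>
      ENNReal.ofReal (e i) / (((0 + i : ℕ) + ρ : ℝ≥0) : ℝ≥0∞) :=
    measurable_pi_iff.2 fun i => (measurable_ofReal_div _).comp (measurable_pi_apply i)
  rw [rowLaw, h, Measure.map_map measurable_partialSums hm', Measure.map_map hs hm]
  congr 1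
  ext e i
  simp [partialSums, Function.comp]

theorem IsBirthImmigration.hasLaw_hitRow {Ω : Type*} [MeasurableSpace Ω] {μ : Measure Ω}
    [IsProbabilityMeasure μ] {δ : ℝ≥0} {X : ℝ≥0 → Ω → ℕ} (h : IsBirthImmigration μ δ X) :
    HasLaw (fun ω => hitRow fun t => X t ω) (rowLaw δ 0) μ where
  aemeasurable := (measurable_hitRow.comp (measurable_pi_iff.2 h.measurable)).aemeasurable
  map_eq := by
    have hm : Measurable fun (e : ℕ → ℝ) (k : ℕ) =>
        ∑ i ∈ Finset.range k, ENNReal.ofReal (e i) / ((i : ℝ≥0∞) + δ) :=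
      measurable_pi_iff.2 fun k => Finset.measurable_sum _ fun i _ =>
        (measurable_ofReal_div _).comp (measurable_pi_apply i)
    have hs : Measurable fun (g : ℕ → ℝ≥0∞) (i : ℕ) => g (i + 1) :=
      measurable_pi_iff.2 fun i => measurable_pi_apply _
    -- Otherwise `Measure.map` would take its default value `0`, whereas the right-hand side of
    -- `hittingTimes` is a probability measure.
    have hae : AEMeasurable (fun ω (k : ℕ) => hittingTime (fun t => X t ω) k) μ := by
      by_contra hnot
      have h0 := h.hittingTimes
      rw [Measure.map_of_not_aemeasurable hnot] at h0
      have := Measure.isProbabilityMeasure_map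
        (μ := Measure.infinitePi fun _ : ℕ => expMeasure 1) hm.aemeasurable
      rw [← h0] at this
      exact this.ne_zero _ rfl
    have e : (fun ω => hitRow fun t => X t ω) =ᵐ[μ]
        (fun (g : ℕ → ℝ≥0∞) (i : ℕ) => g (i + 1)) ∘
          fun ω (k : ℕ) => hittingTime (fun t => X t ω) k := by
      filter_upwards [h.monotone] with ω hω
      ext i
      exact hitRow_eq hω i
    rw [Measure.map_congr e, ← AEMeasurable.map_map_of_aemeasurable hs.aemeasurable hae,
      h.hittingTimes, rowLaw_zero_eq]

/-! ### The joint laws of new nodes and degrees -/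

section Model

variable {Ω : Type*} [MeasurableSpace Ω] {μ : Measure Ω}

theorem map_exponentials {τ τ' : ℕ → ℕ → Ω → ℝ}
    (hτ : ∀ n v, HasLaw (τ n v) (expMeasure 1) μ) (hτ' : ∀ n v, HasLaw (τ' n v) (expMeasure 1) μ)
    (h : iIndepFun
      (Sum.elim (fun (i : ℕ × ℕ) => τ i.1 i.2) (fun (i : ℕ × ℕ) => τ' i.1 i.2)) μ) :
    μ.map (fun ω => (fun n v => τ n v ω, fun n v => τ' n v ω)) =
      (Measure.infinitePi fun _ : ℕ => Measure.infinitePi fun _ : ℕ => expMeasure 1).prod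
        (Measure.infinitePi fun _ : ℕ => Measure.infinitePi fun _ : ℕ => expMeasure 1) := by
  have h1 := map_prodMk_of_iIndepFun_sumElim (M := fun _ : ℕ × ℕ => expMeasure 1)
    (M' := fun _ : ℕ × ℕ => expMeasure 1) (fun i : ℕ × ℕ => hτ i.1 i.2)
    (fun i : ℕ × ℕ => hτ' i.1 i.2) h
  have hc := Measure.infinitePi_map_curry (fun _ _ : ℕ => expMeasure 1)
  have hcm : Measurable (MeasurableEquiv.curry ℕ ℕ ℝ) := (MeasurableEquiv.curry ℕ ℕ ℝ).measurable
  have hae : AEMeasurable (fun ω => (fun i : ℕ × ℕ => τ i.1 i.2 ω, fun i : ℕ × ℕ => τ' i.1 i.2 ω))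
      μ := (aemeasurable_pi_iff.2 fun i : ℕ × ℕ => (hτ i.1 i.2).aemeasurable).prodMk
        (aemeasurable_pi_iff.2 fun i : ℕ × ℕ => (hτ' i.1 i.2).aemeasurable)
  have h2 := congrArg (Measure.map (Prod.map (MeasurableEquiv.curry ℕ ℕ ℝ)
    (MeasurableEquiv.curry ℕ ℕ ℝ))) h1
  rw [AEMeasurable.map_map_of_aemeasurable (hcm.prodMap hcm).aemeasurable hae,
    ← Measure.map_prod_map _ _ hcm hcm] at h2
  refine Eq.trans ?_ (h2.trans ?_)
  · rfl
  · exact congrArg₂ Measure.prod hc hc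

variable [IsProbabilityMeasure μ]

theorem map_hitRows {δ δ' : ℕ → ℝ≥0} {X X' : ℕ → ℝ≥0 → Ω → ℕ}
    (hX : ∀ v, IsBirthImmigration μ (δ v) (X v)) (hX' : ∀ v, IsBirthImmigration μ (δ' v) (X' v))
    (h : iIndepFun
      (Sum.elim (fun v ω t => X v t ω) (fun v ω t => X' v t ω) : ℕ ⊕ ℕ → Ω → ℝ≥0 → ℕ) μ) :
    μ.map (fun ω => (fun v => hitRow fun t => X v t ω, fun v => hitRow fun t => X' v t ω)) =
      (raceLaw δ 0).prod (raceLaw δ' 0) := by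
  refine map_prodMk_of_iIndepFun_sumElim (fun v => (hX v).hasLaw_hitRow)
    (fun v => (hX' v).hasLaw_hitRow) ?_
  convert h.comp (fun _ => hitRow) (fun _ => measurable_hitRow) using 1
  ext (i | i) <;> rfl

/-- The in- and out-degrees of the preferential attachment model and the birth-immigration processes
at the embedded jump times have the same joint law with the sequence of new nodes. -/
theorem map_degrees_eq_map_embeddings (δin δout : ℝ≥0) {B : Ω → ℕ → Bool}
    (hB : AEMeasurable B μ) {τ τ' : ℕ → ℕ → Ω → ℝ}
    (hτ : ∀ n v, HasLaw (τ n v) (expMeasure 1) μ) (hτ' : ∀ n v, HasLaw (τ' n v) (expMeasure 1) μ)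
    (hτ_indep : iIndepFun
      (Sum.elim (fun (i : ℕ × ℕ) => τ i.1 i.2) (fun (i : ℕ × ℕ) => τ' i.1 i.2)) μ)
    (hBτ_indep : IndepFun B (fun ω => ((fun n v => τ n v ω, fun n v => τ' n v ω) :
      (ℕ → ℕ → ℝ) × (ℕ → ℕ → ℝ))) μ)
    {X X' : ℕ → ℝ≥0 → Ω → ℕ}
    (hX : ∀ v, IsBirthImmigration μ ((if v = 0 then 1 else 0) + δin) (X v))
    (hX' : ∀ v, IsBirthImmigration μ (1 + δout) (X' v))
    (hX_indep : iIndepFun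
      (Sum.elim (fun v ω t => X v t ω) (fun v ω t => X' v t ω) : ℕ ⊕ ℕ → Ω → ℝ≥0 → ℕ) μ)
    (hBX_indep : IndepFun B (fun ω => ((fun v t => X v t ω, fun v t => X' v t ω) :
      (ℕ → ℝ≥0 → ℕ) × (ℕ → ℝ≥0 → ℕ))) μ) :
    let D : Ω → (ℕ → ℕ → ℕ) × (ℕ → ℕ → ℕ) := fun ω =>
      (inDegree δin δout (B ω) (fun n v => τ n v ω) (fun n v => τ' n v ω),
        outDegree δin δout (B ω) (fun n v => τ n v ω) (fun n v => τ' n v ω))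
    let Y : Ω → (ℕ → ℕ → ℕ) × (ℕ → ℕ → ℕ) := fun ω =>
      (inEmbedding (B ω) (fun v t => X v t ω), outEmbedding (B ω) (fun v t => X' v t ω))
    AEMeasurable D μ ∧ AEMeasurable Y μ ∧
      μ.map (fun ω => (B ω, D ω)) = μ.map (fun ω => (B ω, Y ω)) := by
  intro D Y
  set ρ : ℕ → ℝ≥0 := fun v => (if v = 0 then 1 else 0) + δin with hρ
  set ρ' : ℕ → ℝ≥0 := fun _ => 1 + δout with hρ'
  have hρ0 : ρ 0 ≠ 0 := by simp [hρ]
  have hρ'0 : ρ' 0 ≠ 0 := by simp [hρ']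
  set ι : ℕ → ℕ := fun v => if v = 0 then 1 else 0
  set P := Measure.infinitePi fun _ : ℕ => Measure.infinitePi fun _ : ℕ => expMeasure 1
  let T : Ω → (ℕ → ℕ → ℝ) × (ℕ → ℕ → ℝ) := fun ω => (fun n v => τ n v ω, fun n v => τ' n v ω)
  let H : Ω → (ℕ → ℕ → ℝ≥0∞) × (ℕ → ℕ → ℝ≥0∞) := fun ω =>
    (fun v => hitRow fun t => X v t ω, fun v => hitRow fun t => X' v t ω)
  let F₁ : (ℕ → Bool) → (ℕ → ℕ → ℝ) × (ℕ → ℕ → ℝ) → (ℕ → ℕ → ℕ) × (ℕ → ℕ → ℕ) := fun b =>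
    Prod.map (urnTally ρ ι (fun _ => true) b) (urnTally ρ' (fun _ => 1) (fun a => !a) b)
  let F₂ : (ℕ → Bool) → (ℕ → ℕ → ℝ≥0∞) × (ℕ → ℕ → ℝ≥0∞) → (ℕ → ℕ → ℕ) × (ℕ → ℕ → ℕ) := fun b =>
    Prod.map (raceTally ι (fun _ => true) b) (raceTally (fun _ => 1) (fun a => !a) b)
  have hF₁ : Measurable fun p : (ℕ → Bool) × _ => F₁ p.1 p.2 :=
    measurable_prodMap_uncurry (measurable_urnTally ρ ι fun _ => true)
      (measurable_urnTally ρ' (fun _ => 1) fun a => !a)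
  have hF₂ : Measurable fun p : (ℕ → Bool) × _ => F₂ p.1 p.2 :=
    measurable_prodMap_uncurry (measurable_raceTally ι fun _ => true)
      (measurable_raceTally (fun _ => 1) fun a => !a)
  have hF : ∀ b, (P.prod P).map (F₁ b) = ((raceLaw ρ 0).prod (raceLaw ρ' 0)).map (F₂ b) := by
    intro b
    have h1 := Measure.map_prod_map P P (measurable_urnTally_apply ρ ι (fun _ => true) b)
      (measurable_urnTally_apply ρ' (fun _ => 1) (fun a => !a) b)
    have h2 := Measure.map_prod_map (raceLaw ρ 0) (raceLaw ρ' 0)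
      (measurable_raceTally_apply ι (fun _ => true) b)
      (measurable_raceTally_apply (fun _ => 1) (fun a => !a) b)
    rw [map_urnTally_eq hρ0, map_urnTally_eq hρ'0] at h1
    exact h1.symm.trans h2
  have hT : AEMeasurable T μ :=
    (aemeasurable_pi_iff.2 fun n => aemeasurable_pi_iff.2 fun v => (hτ n v).aemeasurable).prodMk
      (aemeasurable_pi_iff.2 fun n => aemeasurable_pi_iff.2 fun v => (hτ' n v).aemeasurable)
  have hH : AEMeasurable H μ :=
    (aemeasurable_pi_iff.2 fun v => (hX v).hasLaw_hitRow.aemeasurable).prodMk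
      (aemeasurable_pi_iff.2 fun v => (hX' v).hasLaw_hitRow.aemeasurable)
  have hTlaw : μ.map T = P.prod P := map_exponentials hτ hτ' hτ_indep
  have hHlaw : μ.map H = (raceLaw ρ 0).prod (raceLaw ρ' 0) := map_hitRows hX hX' hX_indep
  have hBT : μ.map (fun ω => (B ω, T ω)) = (μ.map B).prod (P.prod P) := by
    rw [← hTlaw]
    exact (indepFun_iff_map_prod_eq_prod_map_map hB hT).1 hBτ_indep
  have hBH : μ.map (fun ω => (B ω, H ω)) =
      (μ.map B).prod ((raceLaw ρ 0).prod (raceLaw ρ' 0)) := by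
    rw [← hHlaw]
    refine (indepFun_iff_map_prod_eq_prod_map_map hB hH).1 ?_
    have hrows : Measurable fun (x : ℕ → ℝ≥0 → ℕ) v => hitRow (x v) :=
      measurable_pi_iff.2 fun v => measurable_hitRow.comp (measurable_pi_apply v)
    exact hBX_indep.comp measurable_id (hrows.prodMap hrows)
  have hD : D = fun ω => F₁ (B ω) (T ω) := by
    ext1 ω
    simp only [D, F₁, T, Prod.map, urnTally, inDegree_eq_tally, outDegree_eq_tally]
    rfl
  have hY : Y =ᵐ[μ] fun ω => F₂ (B ω) (H ω) := by
    -- The quantifier over all `b` stands inside the almost sure event, so the random sequence `B ω`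
    -- can be inserted afterwards.
    have hg : ∀ᵐ p ∂μ.map H, (∀ b : ℕ → Bool, ∀ n,
        (∀ v, 0 < raceState (nodeCount b) (fun _ => true) p.1 n v 0) ∧
          raceState (nodeCount b) (fun _ => true) p.1 n 0 0 ≠ ∞) ∧ ∀ b : ℕ → Bool, ∀ n,
        (∀ v, 0 < raceState (nodeCount b) (fun n => !b n) p.2 n v 0) ∧
          raceState (nodeCount b) (fun n => !b n) p.2 n 0 0 ≠ ∞ := by
      rw [hHlaw]
      exact (Measure.quasiMeasurePreserving_fst.ae (ae_raceState_pos hρ0 fun _ => true)).and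
        (Measure.quasiMeasurePreserving_snd.ae (ae_raceState_pos hρ'0 fun a => !a))
    filter_upwards [ae_of_ae_map hH hg, ae_all_iff.2 fun v => (hX v).monotone,
      ae_all_iff.2 fun v => (hX' v).monotone, ae_all_iff.2 fun v => (hX v).rightContinuous,
      ae_all_iff.2 fun v => (hX' v).rightContinuous] with ω hgood hm hm' hr hr'
    exact Prod.ext
      (inEmbedding_eq_raceTally (B ω) (funext fun v => funext fun i => hitRow_eq (hm v) i) hm hr
        (hgood.1 (B ω)))
      (outEmbedding_eq_raceTally (B ω) (funext fun v => funext fun i => hitRow_eq (hm' v) i) hm' hr'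
        (hgood.2 (B ω)))
  have hFT := hF₁.comp_aemeasurable (hB.prodMk hT)
  have hFH := hF₂.comp_aemeasurable (hB.prodMk hH)
  refine ⟨hD ▸ hFT, hFH.congr hY.symm, ?_⟩
  have e : (fun ω => (B ω, Y ω)) =ᵐ[μ] fun ω => (B ω, F₂ (B ω) (H ω)) := by
    filter_upwards [hY] with ω hω
    rw [hω]
  have key := map_prodMk_congr (ν := μ.map B) hF₁ hF₂ hF
  rw [← hBT, ← hBH, AEMeasurable.map_map_of_aemeasurable
      (measurable_fst.prodMk hF₁).aemeasurable (hB.prodMk hT),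
    AEMeasurable.map_map_of_aemeasurable
      (measurable_fst.prodMk hF₂).aemeasurable (hB.prodMk hH)] at key
  rw [Measure.map_congr e, hD]
  exact key

end Model

end PrefAttach

/-! ### Conditional and unconditional laws as images of the joint law. -/

theorem theorem3p1 {Ω : Type*} [MeasurableSpace Ω] (μ : Measure Ω) [IsProbabilityMeasure μ]
    (p : unitInterval) (δin δout : ℝ≥0)
    -- the Bernoulli variables: independent and identically distributed
    (B : ℕ → Ω → Bool)
    (hB : ∀ n, HasLaw (B n) (bernoulliMeasure true false p) μ)
    (hB_indep : iIndepFun B μ)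
    -- the exponential variables: independent, of rate one, and independent of the Bernoulli ones
    (τ τ' : ℕ → ℕ → Ω → ℝ)
    (hτ : ∀ n v, HasLaw (τ n v) (expMeasure 1) μ)
    (hτ' : ∀ n v, HasLaw (τ' n v) (expMeasure 1) μ)
    (hτ_indep : iIndepFun
      (Sum.elim (fun (i : ℕ × ℕ) => τ i.1 i.2) (fun (i : ℕ × ℕ) => τ' i.1 i.2)) μ)
    (hBτ_indep : IndepFun (fun ω n => B n ω)
      (fun ω => ((fun n v => τ n v ω, fun n v => τ' n v ω) : (ℕ → ℕ → ℝ) × (ℕ → ℕ → ℝ))) μ)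
    -- the birth-immigration processes: independent, and independent of the Bernoulli variables
    (X X' : ℕ → ℝ≥0 → Ω → ℕ)
    (hX : ∀ v, PrefAttach.IsBirthImmigration μ ((if v = 0 then 1 else 0) + δin) (X v))
    (hX' : ∀ v, PrefAttach.IsBirthImmigration μ (1 + δout) (X' v))
    (hX_indep : iIndepFun
      (Sum.elim (fun v ω t => X v t ω) (fun v ω t => X' v t ω) : ℕ ⊕ ℕ → Ω → ℝ≥0 → ℕ) μ)
    (hBX_indep : IndepFun (fun ω n => B n ω)
      (fun ω => ((fun v t => X v t ω, fun v t => X' v t ω) :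
        (ℕ → ℝ≥0 → ℕ) × (ℕ → ℝ≥0 → ℕ))) μ) :
    let Bseq : Ω → ℕ → Bool := fun ω n => B n ω
    -- in- and out-degrees in the preferential attachment model, after `n` steps
    let I : Ω → ℕ → ℕ → ℕ := fun ω =>
      PrefAttach.inDegree δin δout (Bseq ω) (fun n v => τ n v ω) (fun n v => τ' n v ω)
    let O : Ω → ℕ → ℕ → ℕ := fun ω =>
      PrefAttach.outDegree δin δout (Bseq ω) (fun n v => τ n v ω) (fun n v => τ' n v ω)
    -- the birth-immigration processes at the embedded jump times
    let Y : Ω → ℕ → ℕ → ℕ := fun ω => PrefAttach.inEmbedding (Bseq ω) (fun v t => X v t ω)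
    let Y' : Ω → ℕ → ℕ → ℕ := fun ω => PrefAttach.outEmbedding (Bseq ω) (fun v t => X' v t ω)
    (∀ᵐ b ∂(μ.map Bseq), condDistrib I Bseq μ b = condDistrib Y Bseq μ b) ∧
    (∀ᵐ b ∂(μ.map Bseq), condDistrib O Bseq μ b = condDistrib Y' Bseq μ b) ∧
    (∀ n : ℕ,
      (∀ᵐ b ∂(μ.map Bseq),
        condDistrib (fun ω v => (I ω n v, O ω n v)) Bseq μ b =
          condDistrib (fun ω v => (Y ω n v, Y' ω n v)) Bseq μ b) ∧
      IdentDistrib (fun ω v => (I ω n v, O ω n v)) (fun ω v => (Y ω n v, Y' ω n v)) μ μ) := by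
  intro Bseq I O Y Y'
  have hBseq : AEMeasurable Bseq μ := aemeasurable_pi_iff.2 fun n => (hB n).aemeasurable
  obtain ⟨hD, hE, hlaw⟩ := PrefAttach.map_degrees_eq_map_embeddings δin δout hBseq hτ hτ' hτ_indep
    hBτ_indep hX hX' hX_indep hBX_indep
  have hmeas : ∀ n : ℕ, Measurable fun (p : (ℕ → ℕ → ℕ) × (ℕ → ℕ → ℕ)) v => (p.1 n v, p.2 n v) :=
    fun n => measurable_pi_iff.2 fun v =>
      ((measurable_pi_apply v).comp ((measurable_pi_apply n).comp measurable_fst)).prodMk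
        ((measurable_pi_apply v).comp ((measurable_pi_apply n).comp measurable_snd))
  have hI := PrefAttach.map_prodMk_comp_congr hBseq hD hE measurable_fst hlaw
  have hO := PrefAttach.map_prodMk_comp_congr hBseq hD hE measurable_snd hlaw
  have hn := fun n => PrefAttach.map_prodMk_comp_congr hBseq hD hE (hmeas n) hlaw
  refine ⟨Filter.Eventually.of_forall fun b => ?_, Filter.Eventually.of_forall fun b => ?_,
    fun n => ⟨Filter.Eventually.of_forall fun b => ?_, ?_⟩⟩
  · exact congrArg (fun κ => κ b) (PrefAttach.condDistrib_congr_of_map_prodMk_eq hI)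
  · exact congrArg (fun κ => κ b) (PrefAttach.condDistrib_congr_of_map_prodMk_eq hO)
  · exact congrArg (fun κ => κ b) (PrefAttach.condDistrib_congr_of_map_prodMk_eq (hn n))
  · exact PrefAttach.identDistrib_of_map_prodMk_eq hBseq ((hmeas n).comp_aemeasurable hD)
      ((hmeas n).comp_aemeasurable hE) (hn n)
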